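/- Let $K\subset\mathbb R^2$ be a polygon with possibly curved edges, i.e. a nonempty bounded open set, star-shaped with respect to every point of some ball of positive radius, whose boundary is the union of a finite set $\mathcal E^K$ of edges. Each edge $e$ is the image of a compact interval $I_e=[a_e,b_e]$, $a_e<b_e$, under an injective $C^1$ map $\gamma_e:I_e\to\mathbb R^2$ with $\gamma_e'\neq0$ everywhere (affine if $e$ is straight), and distinct edges meet only at endpoints. Let $x_K$, $h_K$, $|K|$ be the centroid, diameter and area of $K$, let $n_K$ be its outward unit normal, and let $|e|$ be the length of $e$. Let $k\ge1$ be an integer. Let $\mathbb P_n(K)$ be the space of polynomials of total degree at most $n$ on $K$, with $\mathbb P_{-1}(K)=\{0\}$, and let $\widetilde{\mathbb P}_{k-1}(e)=\{q\circ\gamma_e^{-1}: q \text{ a polynomial of degree at most } k-1 \text{ on } I_e\}$. Put $$V_h(K)=\{v\in H^1(K):\ \Delta v\in\mathbb P_{k-2}(K),\ \ n_K\cdot\nabla v\in\widetilde{\mathbb P}_{k-1}(e)\ \text{ for all } e\in\mathcal E^K\},$$ where $\Delta v$ is taken in the sense of distributions and $n_K\cdot\nabla v$ in the sense of Green's formula.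 For $v\in V_h(K)$ consider - the edge moments $$D_e^i(v)=\frac1{|e|}\int_e v\,\widetilde m_i\,\mathrm ds,\qquad \widetilde m_i=m_i\circ\gamma_e^{-1},\quad m_i(t)=\Big(\frac{t-(a_e+b_e)/2}{b_e-a_e}\Big)^i,\quad e\in\mathcal E^K,\ 0\le i\le k-1,$$ where $v$ on $e$ denotes the trace; - the bulk moments $$D_K^\alpha(v)=\frac1{|K|}\int_K v\,\Big(\frac{x-x_K}{h_K}\Big)^\alpha\,\mathrm dx,\qquad \alpha\in\mathbb N^2,\ |\alpha|\le k-2.$$ Then every $v\in V_h(K)$ has a unique trace in $L^2(\partial K)$, these functionals are linear on $V_h(K)$, and they are unisolvent for $V_h(K)$: the map that sends $v\in V_h(K)$ to the family of all the values $D_e^i(v)$, $D_K^\alpha(v)$ is a bijection onto the space of all real families with the same index set. -/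

import Mathlib

open MeasureTheory Filter Topology Set
open scoped ContDiff

/-- The Euclidean plane. -/
abbrev Plane : Type := EuclideanSpace ℝ (Fin 2)

/-- A polygon with possibly curved edges, the edges being indexed by `ι`: a nonempty bounded open
set `K` of the plane that is star-shaped with respect to a ball, and whose boundary is the union of
finitely many regular simple `C¹` arcs `γ e : [a e, b e] → ℝ²` which meet only at endpoints.
A straight edge is an arc whose parametrization is affine. -/
structure CurvedPolygon (ι : Type*) [Fintype ι] where
  /-- the (open) element -/
  K : Set Plane
  isOpen : IsOpen K
  nonempty : K.Nonempty
  bounded : Bornology.IsBounded K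
  /-- star-shapedness with respect to every point of some ball of positive radius -/
  starShaped : ∃ (c : Plane) (r : ℝ), 0 < r ∧ Metric.ball c r ⊆ K ∧
    ∀ y ∈ Metric.ball c r, StarConvex ℝ y K
  /-- left endpoint of the parameter interval of an edge -/
  a : ι → ℝ
  /-- right endpoint of the parameter interval of an edge -/
  b : ι → ℝ
  a_lt_b : ∀ e, a e < b e
  /-- the parametrization of an edge; only its values on `[a e, b e]` matter -/
  γ : ι → ℝ → Plane
  contDiffOn : ∀ e, ContDiffOn ℝ 1 (γ e) (Icc (a e) (b e))
  regular : ∀ e, ∀ t ∈ Icc (a e) (b e), derivWithin (γ e) (Icc (a e) (b e)) t ≠ 0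
  injOn : ∀ e, InjOn (γ e) (Icc (a e) (b e))
  frontier_eq : frontier K = ⋃ e, γ e '' Icc (a e) (b e)
  disjoint : ∀ e e', e ≠ e' → Disjoint (γ e '' Ioo (a e) (b e)) (γ e' '' Icc (a e') (b e'))

namespace CurvedPolygon

variable {ι : Type*} [Fintype ι] (P : CurvedPolygon ι)

/-! ### Measures on the element and on its boundary -/

/-- Lebesgue measure on the element. -/
noncomputable abbrev bulkMeasure : Measure Plane := volume.restrict P.K

/-- Arc length `ds` on the edge `e`: the image under `γ e` of `‖(γ e)'(t)‖ dt` on `[a e, b e]`. -/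
noncomputable def edgeMeasure (e : ι) : Measure Plane :=
  ((volume.restrict (Icc (P.a e) (P.b e))).withDensity fun t =>
    ENNReal.ofReal ‖derivWithin (P.γ e) (Icc (P.a e) (P.b e)) t‖).map (P.γ e)

/-- Arc length `ds` on the whole boundary of the element. -/
noncomputable def bdryMeasure : Measure Plane := ∑ e, P.edgeMeasure e

lemma edgeMeasure_le (e : ι) : P.edgeMeasure e ≤ P.bdryMeasure :=
  Finset.single_le_sum (f := P.edgeMeasure) (fun _ _ => Measure.zero_le _) (Finset.mem_univ e)

/-- The length `|e|` of an edge. -/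
noncomputable def edgeLength (e : ι) : ℝ :=
  ∫ t in P.a e..P.b e, ‖derivWithin (P.γ e) (Icc (P.a e) (P.b e)) t‖

/-- `L²(K)`. -/
abbrev L2 : Type := Lp ℝ 2 P.bulkMeasure

/-- `L²(K; ℝ²)`. -/
abbrev L2Vec : Type := Lp Plane 2 P.bulkMeasure

/-- `L²(∂K)`. -/
abbrev L2Bdry : Type := Lp ℝ 2 P.bdryMeasure

/-! ### Weak derivatives, traces and normal derivatives -/

/-- `φ ∈ C_c^∞(K)`. -/
def IsTest (φ : Plane → ℝ) : Prop :=
  ContDiff ℝ ∞ φ ∧ HasCompactSupport φ ∧ tsupport φ ⊆ P.K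

/-- `g` is the weak gradient of `v` in `K`. So `v ∈ H¹(K)` iff `v` has a weak gradient
`g ∈ L²(K; ℝ²)`. -/
def HasWeakGradient (v : P.L2) (g : P.L2Vec) : Prop :=
  ∀ φ : Plane → ℝ, P.IsTest φ →
    ∫ x in P.K, v x • gradient φ x = -∫ x in P.K, φ x • g x

/-- `f` is the weak divergence of `g` in `K`. If `g` is the weak gradient of `v`, this says
that `f = Δ v` in the sense of distributions. -/
def HasWeakDivergence (g : P.L2Vec) (f : P.L2) : Prop :=
  ∀ φ : Plane → ℝ, P.IsTest φ →
    ∫ x in P.K, inner ℝ (g x) (gradient φ x) = -∫ x in P.K, f x * φ x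

/-- `t` is the trace of `v ∈ H¹(K)` on `∂K`: there are functions `φ n`, smooth up to
the boundary, with `φ n → v` in `H¹(K)` and `φ n → t` in `L²(∂K)`. -/
def IsTrace (v : P.L2) (t : P.L2Bdry) : Prop :=
  ∃ g : P.L2Vec, P.HasWeakGradient v g ∧ ∃ φ : ℕ → Plane → ℝ, (∀ n, ContDiff ℝ ∞ (φ n)) ∧
    Tendsto (fun n => eLpNorm (fun x => φ n x - v x) 2 P.bulkMeasure) atTop (𝓝 0) ∧
    Tendsto (fun n => eLpNorm (fun x => gradient (φ n) x - g x) 2 P.bulkMeasure) atTop (𝓝 0) ∧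
    Tendsto (fun n => eLpNorm (fun x => φ n x - t x) 2 P.bdryMeasure) atTop (𝓝 0)

open Classical in
/-- The trace on `∂K` of a function `v ∈ H¹(K)`. -/
noncomputable def trace (v : P.L2) : P.L2Bdry :=
  if h : ∃ t, P.IsTrace v t then h.choose else 0

/-- For a field `g ∈ L²(K; ℝ²)` with `div g = f ∈ L²(K)`, the outward normal component
`n_K · g ∈ H^{-1/2}(∂K)`, which is defined by Green's formula
`⟨n_K · g, w⟩ = ∫_K g · ∇w + ∫_K f w` for all `w ∈ H¹(K)`, is the function `ψ ∈ L²(∂K)`. -/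
def HasNormalComponent (g : P.L2Vec) (f : P.L2) (ψ : P.L2Bdry) : Prop :=
  ∀ (w : P.L2) (gw : P.L2Vec) (t : P.L2Bdry), P.HasWeakGradient w gw → P.IsTrace w t →
    (∫ x in P.K, inner ℝ (g x) (gw x)) + ∫ x in P.K, f x * w x
      = ∫ x, ψ x * t x ∂P.bdryMeasure

/-! ### Polynomials and mapped polynomials -/

/-- Real polynomials in two variables of total degree at most `n`; it is `{0}` if `n < 0`. -/
noncomputable def polyLE (n : ℤ) : Submodule ℝ (MvPolynomial (Fin 2) ℝ) :=
  MvPolynomial.restrictSupport ℝ {α : Fin 2 →₀ ℕ | (α.degree : ℤ) ≤ n}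

/-- `f ∈ ℙ_n(K)`. -/
def MemBulkPoly (n : ℤ) (f : P.L2) : Prop :=
  ∃ p ∈ polyLE n, ∀ᵐ x ∂P.bulkMeasure, f x = MvPolynomial.eval (fun i => x i) p

/-- The inverse of the parametrization of the edge `e`. -/
noncomputable def γInv (e : ι) : Plane → ℝ :=
  Function.invFunOn (P.γ e) (Icc (P.a e) (P.b e))

/-- The restriction of `ψ ∈ L²(∂K)` to the edge `e` is of the form `q ∘ (γ e)⁻¹` with a polynomial
`q` of degree less than `k` (a mapped polynomial of degree at most `k - 1`). -/
def MemMappedPoly (k : ℕ) (e : ι) (ψ : P.L2Bdry) : Prop :=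
  ∃ q ∈ Polynomial.degreeLT ℝ k, ∀ᵐ x ∂P.edgeMeasure e, ψ x = q.eval (P.γInv e x)

/-! ### The local virtual element space -/

section closure

variable {P}

lemma IsTest.memLp {φ : Plane → ℝ} (h : P.IsTest φ) : MemLp φ 2 P.bulkMeasure :=
  h.1.continuous.memLp_of_hasCompactSupport h.2.1

lemma IsTest.memLp_gradient {φ : Plane → ℝ} (h : P.IsTest φ) :
    MemLp (gradient φ) 2 P.bulkMeasure := by
  have hc : Continuous (gradient φ) :=
    (InnerProductSpace.toDual ℝ Plane).symm.continuous.comp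
      (h.1.continuous_fderiv (by simp))
  refine hc.memLp_of_hasCompactSupport ?_
  have h2 : HasCompactSupport (fderiv ℝ φ) := h.2.1.fderiv ℝ
  exact h2.comp_left (g := (InnerProductSpace.toDual ℝ Plane).symm) (map_zero _)

lemma hasWeakGradient_zero : P.HasWeakGradient 0 0 := by
  intro φ _
  have h1 : ∫ x in P.K, ((0 : P.L2) : Plane → ℝ) x • gradient φ x = 0 := by
    refine integral_eq_zero_of_ae ?_
    filter_upwards [Lp.coeFn_zero ℝ 2 P.bulkMeasure] with x hx
    rw [hx, Pi.zero_apply, zero_smul, Pi.zero_apply]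
  have h2 : ∫ x in P.K, φ x • ((0 : P.L2Vec) : Plane → Plane) x = 0 := by
    refine integral_eq_zero_of_ae ?_
    filter_upwards [Lp.coeFn_zero Plane 2 P.bulkMeasure] with x hx
    rw [hx, Pi.zero_apply, smul_zero]
  rw [h1, h2, neg_zero]

lemma HasWeakGradient.add {v v' : P.L2} {g g' : P.L2Vec} (h : P.HasWeakGradient v g)
    (h' : P.HasWeakGradient v' g') : P.HasWeakGradient (v + v') (g + g') := by
  intro φ hφ
  have i (u : P.L2) : Integrable (fun x => u x • gradient φ x) P.bulkMeasure :=
    memLp_one_iff_integrable.1 (hφ.memLp_gradient.smul (p := 2) (q := 2) (r := 1) (Lp.memLp u))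
  have j (u : P.L2Vec) : Integrable (fun x => φ x • u x) P.bulkMeasure :=
    memLp_one_iff_integrable.1 ((Lp.memLp u).smul (p := 2) (q := 2) (r := 1) hφ.memLp)
  have h1 : ∫ x in P.K, (v + v' : P.L2) x • gradient φ x
      = ∫ x in P.K, (v x • gradient φ x + v' x • gradient φ x) := by
    refine integral_congr_ae ?_
    filter_upwards [Lp.coeFn_add v v'] with x hx
    rw [hx, Pi.add_apply, add_smul]
  have h2 : ∫ x in P.K, φ x • (g + g' : P.L2Vec) x
      = ∫ x in P.K, (φ x • g x + φ x • g' x) := by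
    refine integral_congr_ae ?_
    filter_upwards [Lp.coeFn_add g g'] with x hx
    rw [hx, Pi.add_apply, smul_add]
  rw [h1, h2, integral_add (i v) (i v'), integral_add (j g) (j g'), h φ hφ, h' φ hφ, neg_add]

lemma HasWeakGradient.smul {v : P.L2} {g : P.L2Vec} (c : ℝ) (h : P.HasWeakGradient v g) :
    P.HasWeakGradient (c • v) (c • g) := by
  intro φ hφ
  have h1 : ∫ x in P.K, (c • v : P.L2) x • gradient φ x
      = ∫ x in P.K, c • (v x • gradient φ x) := by
    refine integral_congr_ae ?_
    filter_upwards [Lp.coeFn_smul c v] with x hx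
    rw [hx, Pi.smul_apply, smul_assoc]
  have h2 : ∫ x in P.K, φ x • (c • g : P.L2Vec) x
      = ∫ x in P.K, c • (φ x • g x) := by
    refine integral_congr_ae ?_
    filter_upwards [Lp.coeFn_smul c g] with x hx
    rw [hx, Pi.smul_apply, smul_comm]
  rw [h1, h2, integral_smul, integral_smul, h φ hφ, smul_neg]

lemma hasWeakDivergence_iff {g : P.L2Vec} {f : P.L2} : P.HasWeakDivergence g f ↔
    ∀ φ : Plane → ℝ, ∀ hφ : P.IsTest φ,
      inner ℝ g hφ.memLp_gradient.toLp = -inner ℝ f hφ.memLp.toLp := by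
  refine forall_congr' fun φ => forall_congr' fun hφ => ?_
  rw [L2.inner_def, L2.inner_def]
  have h1 : ∫ x in P.K, inner ℝ (g x) (gradient φ x)
      = ∫ x in P.K, inner ℝ (g x) ((MemLp.toLp _ hφ.memLp_gradient : P.L2Vec) x) := by
    refine integral_congr_ae ?_
    filter_upwards [hφ.memLp_gradient.coeFn_toLp] with x hx
    rw [hx]
  have h2 : ∫ x in P.K, f x * φ x = ∫ x in P.K, inner ℝ (f x) ((MemLp.toLp _ hφ.memLp : P.L2) x) := by
    refine integral_congr_ae ?_
    filter_upwards [hφ.memLp.coeFn_toLp] with x hx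
    rw [hx]
    simp [mul_comm]
  rw [h1, h2]

lemma hasNormalComponent_iff {g : P.L2Vec} {f : P.L2} {ψ : P.L2Bdry} :
    P.HasNormalComponent g f ψ ↔
    ∀ (w : P.L2) (gw : P.L2Vec) (t : P.L2Bdry), P.HasWeakGradient w gw → P.IsTrace w t →
      inner ℝ g gw + inner ℝ f w = inner ℝ ψ t := by
  simp only [L2.inner_def, HasNormalComponent, RCLike.inner_apply, conj_trivial, mul_comm]

end closure

/-- The local nonconforming virtual element space of order `k`,
`V_h(K) = {v ∈ H¹(K) | Δ v ∈ ℙ_{k-2}(K), n_K · ∇v ∈ mapped polynomials of degree ≤ k-1 on e, ∀ e}`,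
as a subspace of `L²(K)`. -/
noncomputable def localSpace (k : ℕ) : Submodule ℝ P.L2 where
  carrier := {v | ∃ (g : P.L2Vec) (f : P.L2) (ψ : P.L2Bdry),
    P.HasWeakGradient v g ∧
    P.HasWeakDivergence g f ∧ P.MemBulkPoly ((k : ℤ) - 2) f ∧
    P.HasNormalComponent g f ψ ∧ ∀ e, P.MemMappedPoly k e ψ}
  zero_mem' := by
    refine ⟨0, 0, 0, hasWeakGradient_zero, ?_, ⟨0, zero_mem _, ?_⟩, ?_, fun e => ⟨0, zero_mem _, ?_⟩⟩
    · exact hasWeakDivergence_iff.2 fun φ hφ => by simp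
    · filter_upwards [Lp.coeFn_zero ℝ 2 P.bulkMeasure] with x hx
      rw [hx, Pi.zero_apply, map_zero]
    · exact hasNormalComponent_iff.2 fun w gw t _ _ => by simp
    · filter_upwards [(Measure.absolutelyContinuous_of_le (P.edgeMeasure_le e)).ae_le
        (Lp.coeFn_zero ℝ 2 P.bdryMeasure)] with x hx
      rw [hx, Pi.zero_apply, Polynomial.eval_zero]
  add_mem' := by
    rintro v v' ⟨g, f, ψ, h1, h2, ⟨p, hp, h3⟩, h4, h5⟩ ⟨g', f', ψ', h1', h2', ⟨p', hp', h3'⟩, h4', h5'⟩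
    refine ⟨g + g', f + f', ψ + ψ', h1.add h1', ?_, ⟨p + p', add_mem hp hp', ?_⟩, ?_, fun e => ?_⟩
    · rw [hasWeakDivergence_iff] at *
      intro φ hφ
      rw [inner_add_left, inner_add_left, h2 φ hφ, h2' φ hφ, neg_add]
    · filter_upwards [Lp.coeFn_add f f', h3, h3'] with x hx h h'
      rw [hx, Pi.add_apply, h, h', map_add]
    · rw [hasNormalComponent_iff] at *
      intro w gw t hw ht
      have e1 := h4 w gw t hw ht
      have e2 := h4' w gw t hw ht
      rw [inner_add_left, inner_add_left, inner_add_left]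
      linarith
    · obtain ⟨q, hq, h⟩ := h5 e
      obtain ⟨q', hq', h'⟩ := h5' e
      refine ⟨q + q', add_mem hq hq', ?_⟩
      filter_upwards [(Measure.absolutelyContinuous_of_le (P.edgeMeasure_le e)).ae_le (Lp.coeFn_add ψ ψ'), h, h']
        with x hx h h'
      rw [hx, Pi.add_apply, h, h', Polynomial.eval_add]
  smul_mem' := by
    rintro c v ⟨g, f, ψ, h1, h2, ⟨p, hp, h3⟩, h4, h5⟩
    refine ⟨c • g, c • f, c • ψ, h1.smul c, ?_, ⟨c • p, Submodule.smul_mem _ c hp, ?_⟩, ?_,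
      fun e => ?_⟩
    · rw [hasWeakDivergence_iff] at *
      intro φ hφ
      rw [real_inner_smul_left, real_inner_smul_left, h2 φ hφ, mul_neg]
    · filter_upwards [Lp.coeFn_smul c f, h3] with x hx h
      rw [hx, Pi.smul_apply, h, MvPolynomial.smul_eval, smul_eq_mul]
    · rw [hasNormalComponent_iff] at *
      intro w gw t hw ht
      rw [real_inner_smul_left, real_inner_smul_left, real_inner_smul_left, ← mul_add,
        h4 w gw t hw ht]
    · obtain ⟨q, hq, h⟩ := h5 e
      refine ⟨c • q, Submodule.smul_mem _ c hq, ?_⟩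
      filter_upwards [(Measure.absolutelyContinuous_of_le (P.edgeMeasure_le e)).ae_le (Lp.coeFn_smul c ψ), h]
        with x hx h
      rw [hx, Pi.smul_apply, h, Polynomial.eval_smul]

/-! ### Degrees of freedom -/

/-- The centroid `x_K`. -/
noncomputable def centroid : Plane := ⨍ x in P.K, x

/-- The scaled monomial `((x - x_K) / h_K) ^ α`, where `h_K` is the diameter of `K`. -/
noncomputable def bulkMonomial (α : Fin 2 →₀ ℕ) (x : Plane) : ℝ :=
  ∏ i, ((x i - P.centroid i) / Metric.diam P.K) ^ α i

/-- The mapped scaled monomial `m_i ∘ (γ e)⁻¹`, where `m_i(t) = ((t - midpoint) / length) ^ i` with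
the midpoint and the length of the parameter interval `[a e, b e]`. -/
noncomputable def edgeMonomial (e : ι) (i : ℕ) (x : Plane) : ℝ :=
  ((P.γInv e x - (P.a e + P.b e) / 2) / (P.b e - P.a e)) ^ i

/-- The edge moment `|e|⁻¹ ∫_e v m̃_i ds`. -/
noncomputable def edgeDof (e : ι) (i : ℕ) (v : P.L2) : ℝ :=
  (P.edgeLength e)⁻¹ * ∫ x, P.trace v x * P.edgeMonomial e i x ∂P.edgeMeasure e

/-- The bulk moment `|K|⁻¹ ∫_K v m_α dx`. -/
noncomputable def bulkDof (α : Fin 2 →₀ ℕ) (v : P.L2) : ℝ :=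
  (volume.real P.K)⁻¹ * ∫ x in P.K, v x * P.bulkMonomial α x

/-- All degrees of freedom of order `k`: the edge moments with `0 ≤ i ≤ k - 1` on every edge, and
the bulk moments with `|α| ≤ k - 2`. -/
noncomputable def dofs (k : ℕ) (v : P.localSpace k) :
    (ι × Fin k) ⊕ {α : Fin 2 →₀ ℕ // (α.degree : ℤ) ≤ (k : ℤ) - 2} → ℝ :=
  Sum.elim (fun s => P.edgeDof s.1 s.2 v) (fun α => P.bulkDof α v)

end CurvedPolygon

/-! Unisolvence is the well-posedness of a moment problem in `H¹(K)`. For `v` in the local space,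
Green's formula with `w = v` reads `‖∇v‖² + ∫ Δv · v = ∫ (n · ∇v) v ds`. Since `Δv` is a combination
of the bulk monomials and `n · ∇v` one of the edge monomials, vanishing moments give `∇v = 0`, and
the mean over one edge (available as `k ≥ 1`) then kills the constant: `eq_zero_of_dofs_eq_zero`.

For surjectivity, the space is not parametrized by Neumann data. The form `∫ ∇u · ∇w + ∑ D_j(u)
D_j(w)` is coercive on `H¹(K)`, so each functional `D_j` has a representer; these span a space on
which the linearly independent `D_j` attain all values (`exists_moments_of_coercive`). A vector
found in this way satisfies `∫ ∇u · ∇w = ∑ l_j D_j(w)` for all `w`, and this is the weak form of a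
Neumann problem whose data are exactly of the kind that defines the local space
(`val_mem_localSpace`). The compatibility condition of the Neumann problem comes for free, by `w =
1`.

The analysis behind it uses only star-shapedness with respect to a ball: smooth functions are dense
in `H¹(K)` (`HasWeakGradient.exists_smooth_approx`), the trace is bounded
(`exists_trace_inequality`), and a Poincaré inequality holds (`exists_poincare`). By the first two,
`IsTrace` is the graph of a continuous operator `traceCLM` (`isTrace_iff`), which makes the edge
moments continuous functionals. -/

/-! ### Star-shaped domains: rays and tangent lines. -/

/-- `K` contains the ball `B(c, r)` and is star-shaped with respect to each of its points. -/
structure StarBall (K : Set Plane) (c : Plane) (r : ℝ) : Prop where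
  pos : 0 < r
  ball_subset : Metric.ball c r ⊆ K
  starConvex : ∀ y ∈ Metric.ball c r, StarConvex ℝ y K

namespace StarBall

variable {K : Set Plane} {c : Plane} {r : ℝ}

/-- A point of the closure can be replaced by a nearby point of `K` at the price of a small shift of
`y`, and the ball is open, so the shifted `y` is still admissible. -/
lemma combo_mem (h : StarBall K c r) {x y : Plane} (hx : x ∈ closure K)
    (hy : y ∈ Metric.ball c r) {s : ℝ} (hs : 0 < s) (hs1 : s ≤ 1) :
    (1 - s) • x + s • y ∈ K := by
  have hF : Tendsto (fun x' : Plane => s⁻¹ • ((1 - s) • x + s • y - (1 - s) • x')) (𝓝 x)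
      (𝓝 y) := by
    have : Continuous (fun x' : Plane => s⁻¹ • ((1 - s) • x + s • y - (1 - s) • x')) := by
      fun_prop
    convert this.tendsto x using 2
    rw [add_sub_cancel_left, smul_smul, inv_mul_cancel₀ hs.ne', one_smul]
  obtain ⟨x', hx'K, hx'⟩ := ((mem_closure_iff_frequently.1 hx).and_eventually
    (hF.eventually (Metric.isOpen_ball.mem_nhds hy))).exists
  have := h.starConvex _ hx' hx'K hs.le (sub_nonneg.2 hs1) (by ring)
  rwa [smul_smul, mul_inv_cancel₀ hs.ne', one_smul, sub_add_cancel] at this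

lemma center_mem_ball (h : StarBall K c r) : c ∈ Metric.ball c r := Metric.mem_ball_self h.pos

lemma notMem_ball_of_mem_frontier (h : StarBall K c r) (hK : IsOpen K) {x : Plane}
    (hx : x ∈ frontier K) : x ∉ Metric.ball c r := fun hxb =>
  (hK.frontier_eq ▸ hx).2 (h.ball_subset hxb)

/-- If `s < s'`, then `x'` lies strictly between `c` and the boundary point `x`, hence in the open
set `K`, and cannot be a boundary point. So each ray from `c` meets the boundary at most once. -/
lemma ray_not_lt (h : StarBall K c r) (hK : IsOpen K) {x x' : Plane} (hx : x ∈ frontier K)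
    (hx' : x' ∈ frontier K) {s s' : ℝ} (hs : 0 < s) (hs' : 0 < s')
    (he : s • (x - c) = s' • (x' - c)) : ¬ s < s' := by
  intro hlt
  have h1 : x' = (1 - (1 - s / s')) • x + (1 - s / s') • c := by
    have : x' - c = (s / s') • (x - c) := by
      rw [div_eq_inv_mul, mul_smul, he, smul_smul, inv_mul_cancel₀ hs'.ne', one_smul]
    rw [sub_sub_cancel, sub_smul, one_smul, ← sub_add_cancel x' c, this, smul_sub]
    abel
  have h2 := h.combo_mem (frontier_subset_closure hx) h.center_mem_ball
    (s := 1 - s / s') (sub_pos.2 ((div_lt_one hs').2 hlt))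
    (by have := div_pos hs hs'; linarith)
  rw [← h1] at h2
  exact (hK.frontier_eq ▸ hx').2 h2

lemma ray_injective (h : StarBall K c r) (hK : IsOpen K) {x x' : Plane} (hx : x ∈ frontier K)
    (hx' : x' ∈ frontier K) {s s' : ℝ} (hs : 0 < s) (hs' : 0 < s')
    (he : s • (x - c) = s' • (x' - c)) : s = s' ∧ x = x' := by
  have h1 : s = s' := le_antisymm (not_lt.1 (h.ray_not_lt hK hx' hx hs' hs he.symm))
    (not_lt.1 (h.ray_not_lt hK hx hx' hs hs' he))
  subst h1
  exact ⟨rfl, sub_left_injective (smul_right_injective _ hs.ne' he)⟩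

/-- A tangent line of the boundary does not meet the ball. -/
lemma le_abs_det_tangent (h : StarBall K c r) (hK : IsOpen K) {γ : ℝ → Plane} {γ' : Plane} {t : ℝ}
    (hγ : HasDerivAt γ γ' t) (hfr : ∀ᶠ u in 𝓝 t, γ u ∈ frontier K) :
    r * ‖γ'‖ ≤ |(γ t - c) 0 * γ' 1 - (γ t - c) 1 * γ' 0| := by
  by_contra! hlt
  set w := γ t - c with hw
  set d := w 0 * γ' 1 - w 1 * γ' 0 with hd
  have hv : 0 < ‖γ'‖ := by
    refine (norm_nonneg _).lt_of_ne fun h0 => ?_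
    rw [← h0, mul_zero] at hlt
    exact (abs_nonneg d).not_gt hlt
  have hn (z : Plane) : ‖z‖ ^ 2 = z 0 ^ 2 + z 1 ^ 2 := by
    simp [EuclideanSpace.norm_sq_eq, Fin.sum_univ_two]
  have hv2 : γ' 0 ^ 2 + γ' 1 ^ 2 ≠ 0 := by rw [← hn]; positivity
  -- `γ t - l • γ'` is the foot of the perpendicular from `c` to the tangent line; its distance from
  -- `c` is `|d| / ‖γ'‖`, which is less than `r` by assumption.
  set l := (w 0 * γ' 0 + w 1 * γ' 1) / ‖γ'‖ ^ 2 with hl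
  have hy : γ t - l • γ' ∈ Metric.ball c r := by
    rw [Metric.mem_ball, dist_eq_norm]
    have h1 : ‖γ t - l • γ' - c‖ ^ 2 * ‖γ'‖ ^ 2 = d ^ 2 := by
      have : γ t - l • γ' - c = w - l • γ' := by rw [hw]; abel
      rw [this, hn, hl, hn γ']
      simp only [PiLp.sub_apply, PiLp.smul_apply, smul_eq_mul]
      field_simp
      ring
    rw [← mul_pow] at h1
    have h2 : ‖γ t - l • γ' - c‖ * ‖γ'‖ = |d| := by
      rw [← abs_of_nonneg (by positivity : 0 ≤ ‖γ t - l • γ' - c‖ * ‖γ'‖)]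
      exact (sq_eq_sq_iff_abs_eq_abs _ _).1 h1
    exact lt_of_mul_lt_mul_right (h2 ▸ hlt) hv.le
  have hl0 : l ≠ 0 := by
    intro h0
    rw [h0, zero_smul, sub_zero] at hy
    exact h.notMem_ball_of_mem_frontier hK hfr.self_of_nhds hy
  have hq : HasDerivAt (fun σ : ℝ => γ (t - l * σ)) (-(l • γ')) 0 := by
    have h1 : HasDerivAt (fun σ : ℝ => t - l * σ) (-l) 0 := by
      simpa using ((hasDerivAt_id (0 : ℝ)).const_mul l).const_sub t
    have h2 : HasDerivAt γ γ' (t - l * 0) := by simpa using hγ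
    rw [← neg_smul]
    exact h2.scomp (0 : ℝ) h1
  -- The secants through `γ t`, extended by the factor `σ⁻¹`, end near the foot and so eventually in
  -- the ball. Then `γ (t - l * σ)` is a combination of a boundary point and a ball point, so it
  -- lies in `K`, although it is on the boundary.
  have hT : Tendsto (fun σ : ℝ => γ t + σ⁻¹ • (γ (t - l * σ) - γ t)) (𝓝[>] 0)
      (𝓝 (γ t - l • γ')) := by
    have h1 := (hasDerivAt_iff_tendsto_slope_zero.1 hq).mono_left
      (nhdsWithin_mono 0 (fun x (hx : 0 < x) => hx.ne') : 𝓝[>] (0 : ℝ) ≤ 𝓝[≠] 0)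
    simpa [sub_eq_add_neg] using h1.const_add (γ t)
  have hfr' : ∀ᶠ σ in 𝓝[>] (0 : ℝ), γ (t - l * σ) ∈ frontier K := by
    have h1 : Tendsto (fun σ : ℝ => t - l * σ) (𝓝[>] 0) (𝓝 t) := by
      have : Continuous (fun σ : ℝ => t - l * σ) := by fun_prop
      have h3 := this.tendsto 0
      simp only [mul_zero, sub_zero] at h3
      exact h3.mono_left nhdsWithin_le_nhds
    exact h1.eventually hfr
  obtain ⟨σ, ⟨h1, h2⟩, h3, h4⟩ := ((hT.eventually (Metric.isOpen_ball.mem_nhds hy)).and hfr').and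
    (Ioo_mem_nhdsGT (zero_lt_one (α := ℝ))) |>.exists
  have h5 := h.combo_mem (frontier_subset_closure hfr.self_of_nhds) h1 h3 h4.le
  have h6 : (1 - σ) • γ t + σ • (γ t + σ⁻¹ • (γ (t - l * σ) - γ t)) = γ (t - l * σ) := by
    rw [smul_add, smul_smul, mul_inv_cancel₀ h3.ne', one_smul, sub_smul, one_smul]
    abel
  rw [h6] at h5
  exact (hK.frontier_eq ▸ h2).2 h5

end StarBall

/-! ### Integration along segments and an inequality of Poincaré type. -/

open scoped ENNReal

lemma sq_lintegral_le {α : Type*} [MeasurableSpace α] (μ : Measure α) {f : α → ℝ≥0∞}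
    (hf : AEMeasurable f μ) : (∫⁻ x, f x ∂μ) ^ 2 ≤ μ univ * ∫⁻ x, f x ^ 2 ∂μ := by
  have h := ENNReal.lintegral_mul_le_Lp_mul_Lq μ Real.HolderConjugate.two_two hf
    (aemeasurable_const (b := (1 : ℝ≥0∞)))
  simp only [Pi.mul_apply, mul_one, ENNReal.one_rpow, lintegral_const, one_mul] at h
  have h2 := pow_le_pow_left₀ (zero_le (a := ∫⁻ x, f x ∂μ)) h 2
  rw [mul_pow, ← ENNReal.rpow_natCast, ← ENNReal.rpow_natCast, ← ENNReal.rpow_mul,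
    ← ENNReal.rpow_natCast, ← ENNReal.rpow_mul] at h2
  norm_num at h2
  rwa [mul_comm]

lemma enorm_sub_sq_le_lintegral {f f' : ℝ → ℝ} (hf : ∀ x, HasDerivAt f (f' x) x)
    (hc : Continuous f') {a b : ℝ} (hab : a ≤ b) :
    ‖f b - f a‖ₑ ^ 2 ≤ ENNReal.ofReal (b - a) * ∫⁻ s in Ioc a b, ‖f' s‖ₑ ^ 2 := by
  have h1 : f b - f a = ∫ s in Ioc a b, f' s := by
    rw [← intervalIntegral.integral_of_le hab,
      intervalIntegral.integral_eq_sub_of_hasDerivAt (fun x _ => hf x) (hc.intervalIntegrable _ _)]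
  calc ‖f b - f a‖ₑ ^ 2 ≤ (∫⁻ s in Ioc a b, ‖f' s‖ₑ) ^ 2 := by
        rw [h1]; gcongr; exact enorm_integral_le_lintegral_enorm _
    _ ≤ _ := by
        refine (sq_lintegral_le _ hc.enorm.measurable.aemeasurable).trans (le_of_eq ?_)
        rw [Measure.restrict_apply_univ, Real.volume_Ioc]

lemma lintegral_comp_affine {F : Plane → ℝ≥0∞} (hF : Measurable F) {s : ℝ} (hs : s ≠ 0)
    (b : Plane) : ∫⁻ x, F (s • x + b) = ENNReal.ofReal |(s ^ 2)⁻¹| * ∫⁻ x, F x := by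
  have h1 : ∫⁻ x, F (s • x + b) = ∫⁻ x, F (x + b) ∂(Measure.map (s • ·) volume) :=
    (lintegral_map (hF.comp (measurable_add_const b)) (measurable_const_smul s)).symm
  rw [h1, Measure.map_addHaar_smul _ hs, lintegral_smul_measure, lintegral_add_right_eq_self]
  simp

/-- The substitution has Jacobian factor `s⁻²` in the plane, at most 4 for `s ≥ 1/2`. -/
lemma setLIntegral_comp_affine_le {F : Plane → ℝ≥0∞} (hF : Measurable F) {A K : Set Plane}
    (hA : MeasurableSet A) (hK : MeasurableSet K) {s : ℝ} (hs : 1 / 2 ≤ s) {b : Plane}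
    (h : ∀ x ∈ A, s • x + b ∈ K) :
    ∫⁻ x in A, F (s • x + b) ≤ 4 * ∫⁻ x in K, F x := by
  have hs0 : 0 < s := by linarith
  calc ∫⁻ x in A, F (s • x + b) ≤ ∫⁻ x, K.indicator F (s • x + b) := by
        rw [← lintegral_indicator hA]
        refine lintegral_mono fun x => ?_
        by_cases hx : x ∈ A
        · rw [indicator_of_mem hx, indicator_of_mem (h x hx)]
        · rw [indicator_of_notMem hx]; exact zero_le
    _ = ENNReal.ofReal |(s ^ 2)⁻¹| * ∫⁻ x in K, F x := by
        rw [lintegral_comp_affine (hF.indicator hK) hs0.ne', lintegral_indicator hK]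
    _ ≤ _ := by
        gcongr
        rw [abs_of_pos (by positivity), ← ENNReal.ofReal_ofNat 4]
        apply ENNReal.ofReal_le_ofReal
        rw [inv_le_comm₀ (by positivity) (by norm_num)]
        nlinarith

lemma norm_gradient (φ : Plane → ℝ) (x : Plane) : ‖gradient φ x‖ = ‖fderiv ℝ φ x‖ := by
  simp [gradient]

lemma enorm_gradient (φ : Plane → ℝ) (x : Plane) : ‖gradient φ x‖ₑ = ‖fderiv ℝ φ x‖ₑ := by
  rw [← ofReal_norm, ← ofReal_norm, norm_gradient]

lemma continuous_gradient {φ : Plane → ℝ} (hφ : ContDiff ℝ 1 φ) : Continuous (gradient φ) :=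
  (InnerProductSpace.toDual ℝ Plane).symm.continuous.comp (hφ.continuous_fderiv (by simp))

/-- The fundamental theorem of calculus along the segment, followed by Cauchy–Schwarz. -/
lemma enorm_sub_sq_le_segment {φ : Plane → ℝ} (hφ : ContDiff ℝ 1 φ) (x y : Plane) {a b : ℝ}
    (hab : a ≤ b) : ‖φ (y + b • (x - y)) - φ (y + a • (x - y))‖ₑ ^ 2 ≤
      ENNReal.ofReal (b - a) * (‖x - y‖ₑ ^ 2 *
        ∫⁻ s in Ioc a b, ‖gradient φ (y + s • (x - y))‖ₑ ^ 2) := by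
  have h1 (s : ℝ) : HasDerivAt (fun s : ℝ => φ (y + s • (x - y)))
      (fderiv ℝ φ (y + s • (x - y)) (x - y)) s := by
    have h2 : HasDerivAt (fun s : ℝ => y + s • (x - y)) (x - y) s := by
      simpa using ((hasDerivAt_id s).smul_const (x - y)).const_add y
    exact ((hφ.differentiable (by simp)) _).hasFDerivAt.comp_hasDerivAt s h2
  have hc : Continuous fun s : ℝ => fderiv ℝ φ (y + s • (x - y)) (x - y) :=
    ((hφ.continuous_fderiv (by simp)).comp (by fun_prop)).clm_apply continuous_const
  refine (enorm_sub_sq_le_lintegral h1 hc hab).trans ?_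
  gcongr
  rw [← lintegral_const_mul' _ _ (by simp)]
  refine lintegral_mono fun s => ?_
  rw [enorm_gradient, ← mul_pow, mul_comm]
  gcongr
  exact ContinuousLinearMap.le_opENorm _ _

namespace StarBall

variable {K : Set Plane} {c : Plane} {r : ℝ}

lemma segment_mem (h : StarBall K c r) {x y : Plane} (hx : x ∈ K) (hy : y ∈ Metric.ball c r)
    {s : ℝ} (hs : s ∈ Ioc (0 : ℝ) 1) : y + s • (x - y) ∈ K := by
  have := h.starConvex y hy hx (sub_nonneg.2 hs.2) hs.1.le (by ring)
  convert this using 1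
  rw [sub_smul, smul_sub, one_smul]; abel

/-- The point `y + s (x - y)` is affine in `x` with factor `s` and in `y` with factor `1 - s`.
Substituting in the variable whose factor is at least `1/2` keeps the constant uniform in `s`, so no
singularity appears at either end of the segment. -/
lemma lintegral_lintegral_segment_le (h : StarBall K c r) (hK : IsOpen K) {F : Plane → ℝ≥0∞}
    (hFc : Continuous F) {s : ℝ} (hs : s ∈ Ioc (0 : ℝ) 1) :
    ∫⁻ x in K, ∫⁻ y in Metric.ball c r, F (y + s • (x - y)) ≤
      4 * (volume K + volume (Metric.ball c r)) * ∫⁻ x in K, F x := by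
  set B := Metric.ball c r with hB
  have hBm : MeasurableSet B := Metric.isOpen_ball.measurableSet
  have hm : Measurable (Function.uncurry fun x y : Plane => F (y + s • (x - y))) :=
    (hFc.comp (by fun_prop : Continuous fun p : Plane × Plane => p.2 + s • (p.1 - p.2))).measurable
  rcases le_total (1 / 2) s with h2 | h2
  · rw [lintegral_lintegral_swap hm.aemeasurable]
    calc ∫⁻ y in B, ∫⁻ x in K, F (y + s • (x - y)) ≤ ∫⁻ y in B, 4 * ∫⁻ x in K, F x := by
          refine setLIntegral_mono measurable_const fun y hy => ?_
          have := setLIntegral_comp_affine_le hFc.measurable hK.measurableSet hK.measurableSet h2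
            (b := y - s • y) (fun x hx => by
              convert h.segment_mem hx hy hs using 1; rw [smul_sub]; abel)
          convert this using 4 with x
          rw [smul_sub]; abel
      _ ≤ _ := by
          rw [setLIntegral_const, mul_comm (4 : ℝ≥0∞) (∫⁻ x in K, F x), mul_assoc, mul_comm]
          gcongr
          exact le_add_self
  · calc ∫⁻ x in K, ∫⁻ y in B, F (y + s • (x - y)) ≤ ∫⁻ x in K, 4 * ∫⁻ x in K, F x := by
          refine setLIntegral_mono measurable_const fun x hx => ?_
          have := setLIntegral_comp_affine_le hFc.measurable hBm hK.measurableSet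
            (s := 1 - s) (by linarith) (b := s • x) (fun y hy => by
              convert h.segment_mem hx hy hs using 1; rw [smul_sub, sub_smul, one_smul]; abel)
          convert this using 4 with y
          rw [smul_sub, sub_smul, one_smul]; abel
      _ ≤ _ := by
          rw [setLIntegral_const, mul_comm (4 : ℝ≥0∞) (∫⁻ x in K, F x), mul_assoc, mul_comm]
          gcongr
          exact le_self_add

lemma lintegral_lintegral_lintegral_segment_le (h : StarBall K c r) (hK : IsOpen K)
    {F : Plane → ℝ≥0∞} (hFc : Continuous F) :
    ∫⁻ x in K, ∫⁻ y in Metric.ball c r, ∫⁻ s in Ioc (0 : ℝ) 1, F (y + s • (x - y)) ≤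
      4 * (volume K + volume (Metric.ball c r)) * ∫⁻ x in K, F x := by
  have hm3 : Measurable fun p : (Plane × ℝ) × Plane => F (p.2 + p.1.2 • (p.1.1 - p.2)) :=
    (hFc.comp (by fun_prop)).measurable
  have h1 (x : Plane) :
      ∫⁻ y in Metric.ball c r, ∫⁻ s in Ioc (0 : ℝ) 1, F (y + s • (x - y)) =
        ∫⁻ s in Ioc (0 : ℝ) 1, ∫⁻ y in Metric.ball c r, F (y + s • (x - y)) := by
    have hm6 : Measurable fun p : Plane × ℝ => F (p.1 + p.2 • (x - p.1)) :=
      (hFc.comp (by fun_prop)).measurable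
    exact lintegral_lintegral_swap (f := fun y s => F (y + s • (x - y))) hm6.aemeasurable
  simp_rw [h1]
  rw [lintegral_lintegral_swap
    (f := fun x s => ∫⁻ y in Metric.ball c r, F (y + s • (x - y)))
    hm3.lintegral_prod_right'.aemeasurable]
  refine (setLIntegral_mono' measurableSet_Ioc fun s hs =>
    h.lintegral_lintegral_segment_le hK hFc hs).trans (le_of_eq ?_)
  rw [setLIntegral_const, Real.volume_Ioc, sub_zero, ENNReal.ofReal_one, mul_one]

/-- A form of the Poincaré inequality, with a constant which depends only on the domain. -/
lemma lintegral_lintegral_enorm_sub_sq_le (h : StarBall K c r) (hK : IsOpen K) {D : ℝ≥0∞}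
    (hDt : D ≠ ⊤) (hD : ∀ x ∈ K, ∀ y ∈ K, ‖x - y‖ₑ ≤ D) {φ : Plane → ℝ} (hφ : ContDiff ℝ 1 φ) :
    ∫⁻ x in K, ∫⁻ y in Metric.ball c r, ‖φ x - φ y‖ₑ ^ 2 ≤
      D ^ 2 * (4 * (volume K + volume (Metric.ball c r)) *
        ∫⁻ x in K, ‖gradient φ x‖ₑ ^ 2) := by
  have hFc : Continuous fun x => ‖gradient φ x‖ₑ ^ 2 :=
    (ENNReal.continuous_pow 2).comp (continuous_gradient hφ).enorm
  have hpt : ∀ x ∈ K, ∀ y ∈ Metric.ball c r, ‖φ x - φ y‖ₑ ^ 2 ≤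
      D ^ 2 * ∫⁻ s in Ioc (0 : ℝ) 1, ‖gradient φ (y + s • (x - y))‖ₑ ^ 2 := by
    intro x hx y hy
    have := enorm_sub_sq_le_segment hφ x y zero_le_one
    rw [one_smul, add_sub_cancel, zero_smul, add_zero, sub_zero, ENNReal.ofReal_one,
      one_mul] at this
    refine this.trans ?_
    gcongr
    exact hD x hx y (h.ball_subset hy)
  have h2 := h.lintegral_lintegral_lintegral_segment_le hK hFc
  refine le_trans ?_ (mul_le_mul_right h2 (D ^ 2))
  rw [← lintegral_const_mul' _ _ (ENNReal.pow_ne_top hDt)]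
  refine setLIntegral_mono' hK.measurableSet fun x hx => ?_
  rw [← lintegral_const_mul' _ _ (ENNReal.pow_ne_top hDt)]
  exact setLIntegral_mono' Metric.isOpen_ball.measurableSet fun y hy => hpt x hx y hy

end StarBall

/-! ### Cones over the edges and the trace inequality. -/

lemma ENNReal.add_sq_le_four_mul (a b : ℝ≥0∞) : (a + b) ^ 2 ≤ 4 * (a ^ 2 + b ^ 2) := by
  rcases le_total a b with h | h
  · calc (a + b) ^ 2 ≤ (b + b) ^ 2 := by gcongr
      _ = 4 * b ^ 2 := by ring
      _ ≤ _ := by gcongr; exact le_add_self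
  · calc (a + b) ^ 2 ≤ (a + a) ^ 2 := by gcongr
      _ = 4 * a ^ 2 := by ring
      _ ≤ _ := by gcongr; exact le_self_add

/-- The identification of `ℝ × ℝ` with the plane. -/
def planeOfProd (q : ℝ × ℝ) : Plane := WithLp.toLp 2 ![q.1, q.2]

lemma measurePreserving_planeOfProd : MeasurePreserving planeOfProd :=
  (PiLp.volume_preserving_toLp (Fin 2)).comp (volume_preserving_finTwoArrow ℝ).symm

namespace StarBall

variable {K : Set Plane} {c : Plane} {r : ℝ}

/-- Change of variables to the cone over a boundary arc. -/
lemma lintegral_cone_le (h : StarBall K c r) (hK : IsOpen K) {γ γ' : ℝ → Plane} {a b : ℝ}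
    (hγ : ∀ t ∈ Ioo a b, HasDerivAt γ (γ' t) t) (hγ' : ContinuousOn γ' (Ioo a b))
    (hfr : ∀ t ∈ Ioo a b, γ t ∈ frontier K) (hinj : InjOn γ (Ioo a b))
    {F : Plane → ℝ≥0∞} (hF : Continuous F) :
    ∫⁻ t in Ioo a b, ∫⁻ s in Ioo (1 / 2 : ℝ) 1,
      ENNReal.ofReal (r / 2 * ‖γ' t‖) * F (c + s • (γ t - c)) ≤ ∫⁻ x in K, F x := by
  have hγc : ContinuousOn γ (Ioo a b) := fun t ht => (hγ t ht).continuousAt.continuousWithinAt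
  -- The Jacobian of `(t, s) ↦ c + s (γ t - c)` is `s` times the determinant of `γ t - c` and `γ'
  -- t`. Keeping `s > 1/2` stays away from the vertex, and the tangent line bound then gives at
  -- least `r / 2 * ‖γ' t‖`.
  set S : Set (ℝ × ℝ) := Ioo a b ×ˢ Ioo (1 / 2 : ℝ) 1 with hS
  have hSm : MeasurableSet S := measurableSet_Ioo.prod measurableSet_Ioo
  set f : ℝ × ℝ → ℝ × ℝ := fun p =>
    (c 0 + p.2 * (γ p.1 - c) 0, c 1 + p.2 * (γ p.1 - c) 1) with hf
  set f' : ℝ × ℝ → (ℝ × ℝ →L[ℝ] ℝ × ℝ) := fun p =>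
    (Matrix.toLin (.finTwoProd ℝ) (.finTwoProd ℝ)
      !![p.2 * γ' p.1 0, (γ p.1 - c) 0; p.2 * γ' p.1 1, (γ p.1 - c) 1]).toContinuousLinearMap
    with hf'
  have hfm (p : ℝ × ℝ) : planeOfProd (f p) = c + p.2 • (γ p.1 - c) := by
    ext i
    fin_cases i <;> simp [planeOfProd, hf]
  have hder : ∀ p ∈ S, HasFDerivWithinAt f (f' p) S p := by
    intro p hp
    have hg (i : Fin 2) : HasDerivAt (fun t => (γ t - c) i) (γ' p.1 i) p.1 := by
      have := (EuclideanSpace.proj (𝕜 := ℝ) i).hasFDerivAt.comp_hasDerivAt p.1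
        ((hγ p.1 hp.1).sub_const c)
      exact this
    have hg2 (i : Fin 2) := ((hasFDerivAt_snd (𝕜 := ℝ) (p := p)).mul
      ((hg i).comp_hasFDerivAt p hasFDerivAt_fst)).const_add (c i)
    have := ((hg2 0).prodMk (hg2 1)).hasFDerivWithinAt (s := S)
    convert! this using 1
    simp only [hf']
    rw [Matrix.toLin_finTwoProd_toContinuousLinearMap]
    simp [smul_smul]
  have hfinj : InjOn f S := by
    intro p hp q hq hpq
    have h1 : p.2 • (γ p.1 - c) = q.2 • (γ q.1 - c) := by
      have := congrArg planeOfProd hpq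
      rw [hfm, hfm] at this
      exact add_left_cancel this
    have h2 := h.ray_injective hK (hfr _ hp.1) (hfr _ hq.1)
      (by have := hp.2.1; linarith) (by have := hq.2.1; linarith) h1
    exact Prod.ext (hinj hp.1 hq.1 h2.2) h2.1
  have hdet : ∀ p ∈ S, r / 2 * ‖γ' p.1‖ ≤ |(f' p).det| := by
    intro p hp
    have h1 := h.le_abs_det_tangent hK (hγ p.1 hp.1)
      (Filter.mem_of_superset (isOpen_Ioo.mem_nhds hp.1) hfr)
    have h2 : (f' p).det =
        -(p.2 * ((γ p.1 - c) 0 * γ' p.1 1 - (γ p.1 - c) 1 * γ' p.1 0)) := by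
      simp only [hf', LinearMap.det_toContinuousLinearMap, LinearMap.det_toLin,
        Matrix.det_fin_two_of]
      ring
    have hp2 : 1 / 2 < p.2 := hp.2.1
    rw [h2, abs_neg, abs_mul, abs_of_pos (by linarith : 0 < p.2)]
    have := mul_nonneg h.pos.le (norm_nonneg (γ' p.1))
    nlinarith
  have hmeas : AEMeasurable (fun p : ℝ × ℝ =>
      ENNReal.ofReal (r / 2 * ‖γ' p.1‖) * F (c + p.2 • (γ p.1 - c))) (volume.restrict S) := by
    have c1 : ContinuousOn (fun p : ℝ × ℝ => γ' p.1) S :=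
      hγ'.comp continuousOn_fst fun p hp => hp.1
    have c2 : ContinuousOn (fun p : ℝ × ℝ => γ p.1) S :=
      hγc.comp continuousOn_fst fun p hp => hp.1
    refine AEMeasurable.mul ?_ ?_
    · exact (ENNReal.continuous_ofReal.comp_continuousOn
        (continuousOn_const.mul c1.norm)).aemeasurable hSm
    · exact (hF.comp_continuousOn (continuousOn_const.add
        (continuousOn_snd.smul (c2.sub continuousOn_const)))).aemeasurable hSm
  have hprod : (volume.restrict (Ioo a b)).prod (volume.restrict (Ioo (1 / 2 : ℝ) 1)) =
      (volume : Measure (ℝ × ℝ)).restrict S := by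
    rw [Measure.prod_restrict]; rfl
  calc ∫⁻ t in Ioo a b, ∫⁻ s in Ioo (1 / 2 : ℝ) 1,
        ENNReal.ofReal (r / 2 * ‖γ' t‖) * F (c + s • (γ t - c))
      = ∫⁻ p in S, ENNReal.ofReal (r / 2 * ‖γ' p.1‖) * F (c + p.2 • (γ p.1 - c)) := by
        rw [← hprod, lintegral_prod _ (hprod ▸ hmeas)]
    _ ≤ ∫⁻ p in S, ENNReal.ofReal |(f' p).det| * F (planeOfProd (f p)) := by
        refine setLIntegral_mono' hSm fun p hp => ?_
        rw [hfm]
        gcongr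
        exact hdet p hp
    _ = ∫⁻ q in f '' S, F (planeOfProd q) :=
        (lintegral_image_eq_lintegral_abs_det_fderiv_mul volume hSm hder hfinj
          (fun q => F (planeOfProd q))).symm
    _ ≤ ∫⁻ q in planeOfProd ⁻¹' K, F (planeOfProd q) := by
        refine lintegral_mono_set ?_
        rintro _ ⟨p, hp, rfl⟩
        rw [mem_preimage, hfm]
        have hp2 : 1 / 2 < p.2 := hp.2.1
        have hp3 : p.2 < 1 := hp.2.2
        have := h.combo_mem (frontier_subset_closure (hfr _ hp.1)) h.center_mem_ball
          (s := 1 - p.2) (by linarith) (by linarith)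
        convert this using 1
        rw [sub_sub_cancel, sub_smul, one_smul, smul_sub]; abel
    _ = ∫⁻ x in K, F x :=
        measurePreserving_planeOfProd.setLIntegral_comp_preimage hK.measurableSet hF.measurable

end StarBall

/-- For each `s` in `(1/2, 1)`, `φ x` is the value at the ray point plus an integral of the
derivative; squaring costs a factor 4, and the bound is averaged over `s`. The interval has length
`1/2`, so averaging doubles the 4 in front of the values, while the gradient term does not depend on
`s` and keeps `4 D²`. -/
lemma enorm_sq_le_lintegral_ray {φ : Plane → ℝ} (hφ : ContDiff ℝ 1 φ) {D : ℝ≥0∞}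
    {x c : Plane} (hD : ‖x - c‖ₑ ≤ D) :
    ‖φ x‖ₑ ^ 2 ≤ (8 + 4 * D ^ 2) * ∫⁻ s in Ioo (1 / 2 : ℝ) 1,
      (‖φ (c + s • (x - c))‖ₑ ^ 2 + ‖gradient φ (c + s • (x - c))‖ₑ ^ 2) := by
  have hF1 : Continuous fun s : ℝ => ‖φ (c + s • (x - c))‖ₑ ^ 2 :=
    (ENNReal.continuous_pow 2).comp (hφ.continuous.comp (by fun_prop)).enorm
  set I := ∫⁻ s in Ioo (1 / 2 : ℝ) 1, ‖gradient φ (c + s • (x - c))‖ₑ ^ 2 with hI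
  set J := ∫⁻ s in Ioo (1 / 2 : ℝ) 1, ‖φ (c + s • (x - c))‖ₑ ^ 2 with hJ
  have h1 : ∀ s ∈ Ioo (1 / 2 : ℝ) 1, ‖φ x‖ₑ ^ 2 ≤
      4 * ‖φ (c + s • (x - c))‖ₑ ^ 2 + 4 * (D ^ 2 * I) := by
    intro s hs
    have h2 := enorm_sub_sq_le_segment hφ x c hs.2.le
    rw [one_smul, add_sub_cancel] at h2
    have h3 : ‖φ x‖ₑ ≤ ‖φ (c + s • (x - c))‖ₑ + ‖φ x - φ (c + s • (x - c))‖ₑ := by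
      conv_lhs => rw [← add_sub_cancel (φ (c + s • (x - c))) (φ x)]
      exact enorm_add_le _ _
    refine (pow_le_pow_left₀ zero_le h3 2).trans ((ENNReal.add_sq_le_four_mul _ _).trans ?_)
    rw [mul_add]
    gcongr
    refine h2.trans ?_
    rw [hI, restrict_Ioo_eq_restrict_Ioc]
    calc _ ≤ 1 * (D ^ 2 * ∫⁻ s in Ioc (1 / 2 : ℝ) 1, ‖gradient φ (c + s • (x - c))‖ₑ ^ 2) := by
          gcongr
          · rw [ENNReal.ofReal_le_one]; linarith [hs.1]
          · exact hs.1.le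
      _ = _ := one_mul _
  have hv : volume (Ioo (1 / 2 : ℝ) 1) = 2⁻¹ := by
    rw [Real.volume_Ioo, ← ENNReal.ofReal_ofNat 2, ← ENNReal.ofReal_inv_of_pos (by norm_num)]
    norm_num
  have h4 : ∫⁻ _ in Ioo (1 / 2 : ℝ) 1, ‖φ x‖ₑ ^ 2 ≤
      ∫⁻ s in Ioo (1 / 2 : ℝ) 1, (4 * ‖φ (c + s • (x - c))‖ₑ ^ 2 + 4 * (D ^ 2 * I)) :=
    setLIntegral_mono' measurableSet_Ioo h1
  rw [lintegral_add_right _ measurable_const, lintegral_const_mul _ hF1.measurable,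
    setLIntegral_const, setLIntegral_const, hv, ← hJ] at h4
  rw [lintegral_add_left hF1.measurable, ← hI, ← hJ]
  have h22 : (2 : ℝ≥0∞) * 2⁻¹ = 1 := ENNReal.mul_inv_cancel (by norm_num) (by norm_num)
  calc ‖φ x‖ₑ ^ 2 = 2 * (‖φ x‖ₑ ^ 2 * 2⁻¹) := by
        rw [mul_comm (‖φ x‖ₑ ^ 2), ← mul_assoc, h22, one_mul]
    _ ≤ 2 * (4 * J + 4 * (D ^ 2 * I) * 2⁻¹) := by gcongr
    _ = 8 * J + 4 * D ^ 2 * I * (2 * 2⁻¹) := by ring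
    _ = 8 * J + 4 * D ^ 2 * I := by rw [h22, mul_one]
    _ ≤ (8 + 4 * D ^ 2) * J + (8 + 4 * D ^ 2) * I := by
        gcongr
        · exact le_self_add
        · exact le_add_self
    _ = _ := by rw [mul_add]

namespace CurvedPolygon

variable {ι : Type*} [Fintype ι] (P : CurvedPolygon ι)

lemma exists_starBall : ∃ c r, StarBall P.K c r := by
  obtain ⟨c, r, h1, h2, h3⟩ := P.starShaped
  exact ⟨c, r, h1, h2, h3⟩

lemma hasDerivAt_γ (e : ι) {t : ℝ} (ht : t ∈ Ioo (P.a e) (P.b e)) :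
    HasDerivAt (P.γ e) (derivWithin (P.γ e) (Icc (P.a e) (P.b e)) t) t :=
  (((P.contDiffOn e).differentiableOn (by simp)) t
    (Ioo_subset_Icc_self ht)).hasDerivWithinAt.hasDerivAt (Icc_mem_nhds ht.1 ht.2)

lemma continuousOn_derivWithin_γ (e : ι) :
    ContinuousOn (derivWithin (P.γ e) (Icc (P.a e) (P.b e))) (Icc (P.a e) (P.b e)) :=
  (P.contDiffOn e).continuousOn_derivWithin (uniqueDiffOn_Icc (P.a_lt_b e)) (by simp)

lemma γ_mem_frontier (e : ι) {t : ℝ} (ht : t ∈ Icc (P.a e) (P.b e)) : P.γ e t ∈ frontier P.K := by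
  rw [P.frontier_eq]
  exact mem_iUnion.2 ⟨e, mem_image_of_mem _ ht⟩

lemma aemeasurable_γ (e : ι) :
    AEMeasurable (P.γ e) (volume.restrict (Icc (P.a e) (P.b e))) :=
  (P.contDiffOn e).continuousOn.aemeasurable measurableSet_Icc

lemma aemeasurable_enorm_derivWithin_γ (e : ι) :
    AEMeasurable (fun t => ENNReal.ofReal ‖derivWithin (P.γ e) (Icc (P.a e) (P.b e)) t‖)
      (volume.restrict (Icc (P.a e) (P.b e))) :=
  (ENNReal.continuous_ofReal.comp_continuousOn
    (P.continuousOn_derivWithin_γ e).norm).aemeasurable measurableSet_Icc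

/-- The endpoints are a null set; the open interval is the form needed for cones, where `γ` is
differentiable in the full sense. -/
lemma lintegral_edgeMeasure (e : ι) {F : Plane → ℝ≥0∞} (hF : Measurable F) :
    ∫⁻ x, F x ∂P.edgeMeasure e = ∫⁻ t in Ioo (P.a e) (P.b e),
      ENNReal.ofReal ‖derivWithin (P.γ e) (Icc (P.a e) (P.b e)) t‖ * F (P.γ e t) := by
  have h1 := (P.aemeasurable_γ e).mono_ac (withDensity_absolutelyContinuous _ fun t =>
    ENNReal.ofReal ‖derivWithin (P.γ e) (Icc (P.a e) (P.b e)) t‖)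
  rw [edgeMeasure, lintegral_map' hF.aemeasurable h1, restrict_Ioo_eq_restrict_Icc]
  exact lintegral_withDensity_eq_lintegral_mul₀ (P.aemeasurable_enorm_derivWithin_γ e)
    (hF.comp_aemeasurable (P.aemeasurable_γ e))

lemma exists_diam_bound : ∃ D : ℝ≥0∞, D ≠ ⊤ ∧
    ∀ x ∈ closure P.K, ∀ y ∈ closure P.K, ‖x - y‖ₑ ≤ D := by
  refine ⟨Metric.ediam (closure P.K), P.bounded.closure.ediam_ne_top, fun x hx y hy => ?_⟩
  rw [← edist_eq_enorm_sub]
  exact Metric.edist_le_ediam_of_mem hx hy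

/-- The trace inequality for smooth functions. -/
lemma exists_trace_inequality : ∃ C : ℝ≥0∞, C ≠ ⊤ ∧ ∀ φ : Plane → ℝ, ContDiff ℝ 1 φ →
    ∫⁻ x, ‖φ x‖ₑ ^ 2 ∂P.bdryMeasure ≤
      C * ∫⁻ x in P.K, (‖φ x‖ₑ ^ 2 + ‖gradient φ x‖ₑ ^ 2) := by
  obtain ⟨c, r, h⟩ := P.exists_starBall
  obtain ⟨D, hDt, hD⟩ := P.exists_diam_bound
  have hr2 : ENNReal.ofReal (r / 2) ≠ 0 := by
    rw [Ne, ENNReal.ofReal_eq_zero, not_le]; exact half_pos h.pos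
  -- Per edge: the constant of the ray estimate, divided by the factor `r / 2` from the Jacobian of
  -- the cone. The sum over edges adds the factor `Fintype.card ι`.
  refine ⟨Fintype.card ι * ((8 + 4 * D ^ 2) * (ENNReal.ofReal (r / 2))⁻¹), ?_, fun φ hφ => ?_⟩
  · refine ENNReal.mul_ne_top (by simp) (ENNReal.mul_ne_top ?_ (ENNReal.inv_ne_top.2 hr2))
    exact ENNReal.add_ne_top.2 ⟨by simp, ENNReal.mul_ne_top (by simp) (ENNReal.pow_ne_top hDt)⟩
  set F : Plane → ℝ≥0∞ := fun x => ‖φ x‖ₑ ^ 2 + ‖gradient φ x‖ₑ ^ 2 with hFdef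
  have hF1 : Continuous fun x => ‖φ x‖ₑ ^ 2 := (ENNReal.continuous_pow 2).comp hφ.continuous.enorm
  have hF : Continuous F :=
    hF1.add ((ENNReal.continuous_pow 2).comp (continuous_gradient hφ).enorm)
  have hedge (e : ι) : ∫⁻ x, ‖φ x‖ₑ ^ 2 ∂P.edgeMeasure e ≤
      (8 + 4 * D ^ 2) * (ENNReal.ofReal (r / 2))⁻¹ * ∫⁻ x in P.K, F x := by
    set g' := derivWithin (P.γ e) (Icc (P.a e) (P.b e)) with hg'
    have hcone := h.lintegral_cone_le P.isOpen (γ := P.γ e) (γ' := g') (a := P.a e) (b := P.b e)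
      (fun t ht => P.hasDerivAt_γ e ht)
      ((P.continuousOn_derivWithin_γ e).mono Ioo_subset_Icc_self)
      (fun t ht => P.γ_mem_frontier e (Ioo_subset_Icc_self ht))
      ((P.injOn e).mono Ioo_subset_Icc_self) hF
    rw [P.lintegral_edgeMeasure e hF1.measurable]
    calc ∫⁻ t in Ioo (P.a e) (P.b e), ENNReal.ofReal ‖g' t‖ * ‖φ (P.γ e t)‖ₑ ^ 2
        ≤ ∫⁻ t in Ioo (P.a e) (P.b e), (8 + 4 * D ^ 2) * (ENNReal.ofReal (r / 2))⁻¹ *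
            ∫⁻ s in Ioo (1 / 2 : ℝ) 1,
              ENNReal.ofReal (r / 2 * ‖g' t‖) * F (c + s • (P.γ e t - c)) := by
          refine setLIntegral_mono' measurableSet_Ioo fun t ht => ?_
          rw [lintegral_const_mul' _ _ (by simp), ENNReal.ofReal_mul (half_pos h.pos).le]
          have := enorm_sq_le_lintegral_ray hφ (x := P.γ e t) (c := c) (hD _
            (frontier_subset_closure (P.γ_mem_frontier e (Ioo_subset_Icc_self ht))) _
            (subset_closure (h.ball_subset h.center_mem_ball)))
          calc _ ≤ ENNReal.ofReal ‖g' t‖ * ((8 + 4 * D ^ 2) * ∫⁻ s in Ioo (1 / 2 : ℝ) 1,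
                F (c + s • (P.γ e t - c))) := by gcongr
            _ = ((ENNReal.ofReal (r / 2))⁻¹ * ENNReal.ofReal (r / 2)) * (ENNReal.ofReal ‖g' t‖ *
                ((8 + 4 * D ^ 2) * ∫⁻ s in Ioo (1 / 2 : ℝ) 1,
                F (c + s • (P.γ e t - c)))) := by
                rw [ENNReal.inv_mul_cancel hr2 ENNReal.ofReal_ne_top, one_mul]
            _ = _ := by ring
      _ = (8 + 4 * D ^ 2) * (ENNReal.ofReal (r / 2))⁻¹ * ∫⁻ t in Ioo (P.a e) (P.b e),
            ∫⁻ s in Ioo (1 / 2 : ℝ) 1,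
              ENNReal.ofReal (r / 2 * ‖g' t‖) * F (c + s • (P.γ e t - c)) := by
          refine lintegral_const_mul' _ _ (ENNReal.mul_ne_top ?_ (ENNReal.inv_ne_top.2 hr2))
          exact ENNReal.add_ne_top.2
            ⟨by simp, ENNReal.mul_ne_top (by simp) (ENNReal.pow_ne_top hDt)⟩
      _ ≤ _ := by gcongr
  rw [bdryMeasure, lintegral_finsetSum_measure]
  refine (Finset.sum_le_sum fun e _ => hedge e).trans (le_of_eq ?_)
  rw [Finset.sum_const, Finset.card_univ, nsmul_eq_mul]
  ring

end CurvedPolygon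

/-! ### Averaging towards the ball and density of smooth functions in `H¹(K)`. -/

lemma eLpNorm_two_sq {α E : Type*} [MeasurableSpace α] [NormedAddCommGroup E] (f : α → E)
    (μ : Measure α) : eLpNorm f 2 μ ^ 2 = ∫⁻ x, ‖f x‖ₑ ^ 2 ∂μ := by
  have := eLpNorm_nnreal_pow_eq_lintegral (f := f) (μ := μ) (p := 2) (by norm_num)
  norm_num at this
  exact_mod_cast this

lemma ENNReal.exists_pos_mul_sq_le {C δ : ℝ≥0∞} (hC : C ≠ ⊤) (hδ : δ ≠ 0) :
    ∃ η : ℝ, 0 < η ∧ C * ENNReal.ofReal η ^ 2 ≤ δ := by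
  have h1 : Continuous fun η : ℝ => C * ENNReal.ofReal η ^ 2 :=
    (ENNReal.continuous_const_mul hC).comp
      ((ENNReal.continuous_pow 2).comp ENNReal.continuous_ofReal)
  have h2 : ∀ᶠ η in 𝓝[>] (0 : ℝ), C * ENNReal.ofReal η ^ 2 < δ :=
    (h1.tendsto 0).mono_left nhdsWithin_le_nhds |>.eventually
      (gt_mem_nhds (by simpa [pos_iff_ne_zero] using hδ))
  obtain ⟨η, h3, h4⟩ := (h2.and self_mem_nhdsWithin).exists
  exact ⟨η, h4, h3.le⟩

section Averaging

variable {E : Type*} [NormedAddCommGroup E] [MeasurableSpace E] [BorelSpace E] [SecondCountableTopology E] {ν : Measure Plane}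
  [IsProbabilityMeasure ν] {M : ℝ≥0∞}

/-- Since `ν` has density at most `M`, the affine substitution bounds the square integral, and
square integrability implies integrability for a probability measure. -/
lemma integrable_comp_affine (hM : M ≠ ⊤) (hν : ν ≤ M • volume) {u : Plane → E}
    (hu : Measurable u) (hu2 : MemLp u 2) {s : ℝ} (hs : s ≠ 0) (b : Plane) :
    Integrable (fun y => u (s • y + b)) ν := by
  have hm : Measurable fun y : Plane => u (s • y + b) := hu.comp (by fun_prop)
  refine ⟨hm.aestronglyMeasurable, ?_⟩
  have h1 := sq_lintegral_le ν hm.enorm.aemeasurable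
  rw [measure_univ, one_mul] at h1
  have h2 : ∫⁻ y, ‖u (s • y + b)‖ₑ ^ 2 ∂ν < ⊤ := by
    refine (lintegral_mono' hν le_rfl).trans_lt ?_
    rw [lintegral_smul_measure, lintegral_comp_affine (hu.enorm.pow_const 2) hs b,
      ← eLpNorm_two_sq]
    exact ENNReal.mul_lt_top hM.lt_top (ENNReal.mul_lt_top ENNReal.ofReal_lt_top
      (ENNReal.pow_lt_top hu2.2))
  by_contra h3
  rw [HasFiniteIntegral, not_lt, top_le_iff] at h3
  rw [h3] at h1
  simp only [ne_eq, OfNat.ofNat_ne_zero, not_false_eq_true, ENNReal.top_pow, top_le_iff] at h1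
  exact h2.ne h1

variable [NormedSpace ℝ E] [CompleteSpace E]

/-- Jensen's inequality for the probability measure `ν`, in the form of Cauchy–Schwarz. -/
lemma enorm_average_sub_sq_le (hM : M ≠ ⊤) (hν : ν ≤ M • volume) {u : Plane → E}
    (hu : Measurable u) (hu2 : MemLp u 2) {ε : ℝ} (hε : ε ≠ 0) (x : Plane) :
    ‖(∫ y, u ((1 - ε) • x + ε • y) ∂ν) - u x‖ₑ ^ 2 ≤
      ∫⁻ y, ‖u ((1 - ε) • x + ε • y) - u x‖ₑ ^ 2 ∂ν := by
  have hi : Integrable (fun y => u ((1 - ε) • x + ε • y)) ν := by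
    simpa only [add_comm] using integrable_comp_affine hM hν hu hu2 hε ((1 - ε) • x)
  have h1 : (∫ y, u ((1 - ε) • x + ε • y) ∂ν) - u x =
      ∫ y, (u ((1 - ε) • x + ε • y) - u x) ∂ν := by
    rw [integral_sub hi (integrable_const _)]; simp
  have hm : Measurable fun y : Plane => u ((1 - ε) • x + ε • y) - u x :=
    (hu.comp (by fun_prop)).sub_const _
  calc _ ≤ (∫⁻ y, ‖u ((1 - ε) • x + ε • y) - u x‖ₑ ∂ν) ^ 2 := by
        rw [h1]; gcongr; exact enorm_integral_le_lintegral_enorm _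
    _ ≤ _ := by
        simpa using sq_lintegral_le ν hm.enorm.aemeasurable

/-- The averages `∫ u((1 - ε) x + ε y) dν(y)` converge to `u` in `L²(K)`. -/
lemma exists_average_sub_le (hM : M ≠ ⊤) (hν : ν ≤ M • volume) {K : Set Plane}
    (hK : MeasurableSet K) (hKb : Bornology.IsBounded K) (hνK : ∀ᵐ y ∂ν, y ∈ K) {u : Plane → E}
    (hu : Measurable u) (hu2 : MemLp u 2) {δ : ℝ≥0∞} (hδ : δ ≠ 0) :
    ∃ ε₀ : ℝ, 0 < ε₀ ∧ ∀ ε ∈ Ioo 0 ε₀,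
      ∫⁻ x in K, ‖(∫ y, u ((1 - ε) • x + ε • y) ∂ν) - u x‖ₑ ^ 2 ≤ δ := by
  have hKv : volume K ≠ ⊤ := hKb.measure_lt_top.ne
  -- The total error below is `16 * 4 η² + 16 η² * volume K + 16 η²`: the averaged approximation
  -- error, the oscillation of `w`, and the approximation error itself.
  obtain ⟨η, hη, hηδ⟩ := ENNReal.exists_pos_mul_sq_le (C := 80 + 16 * volume K)
    (ENNReal.add_ne_top.2 ⟨by simp, ENNReal.mul_ne_top (by simp) hKv⟩) hδ
  obtain ⟨w, hwc, hwu, hw, -⟩ := hu2.exists_hasCompactSupport_eLpNorm_sub_le (by simp)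
    (ε := ENNReal.ofReal η) (by simpa using hη)
  have hwu2 : ∫⁻ x, ‖(u - w) x‖ₑ ^ 2 ≤ ENNReal.ofReal η ^ 2 := by
    rw [← eLpNorm_two_sq]; gcongr
  obtain ⟨d, hd, hwd⟩ := Metric.uniformContinuous_iff.1
    (hwc.uniformContinuous_of_continuous hw) η hη
  obtain ⟨D, hD⟩ := Metric.isBounded_iff.1 hKb
  have hD' : 0 < |D| + 1 := by positivity
  -- The bound `1/2` keeps the factor `1 - ε` of the substitution at least `1/2`; the other bound
  -- puts `(1 - ε) x + ε y` within `d` of `x`, where `w` oscillates by less than `η`.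
  refine ⟨min (1 / 2) (d / (|D| + 1)), by positivity, fun ε hε => ?_⟩
  have hε0 : 0 < ε := hε.1
  have hε1 : ε < 1 / 2 := hε.2.trans_le (min_le_left _ _)
  have hε2 : ε * (|D| + 1) < d := (lt_div_iff₀ hD').1 (hε.2.trans_le (min_le_right _ _))
  have hmw : Measurable w := hw.measurable
  have hm1 : Measurable fun x => ‖(u - w) x‖ₑ ^ 2 := (hu.sub hmw).enorm.pow_const 2
  have hm2 : Measurable fun p : Plane × Plane => ‖(u - w) ((1 - ε) • p.1 + ε • p.2)‖ₑ ^ 2 :=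
    hm1.comp (by fun_prop)
  have hpt : ∀ x ∈ K, ‖(∫ y, u ((1 - ε) • x + ε • y) ∂ν) - u x‖ₑ ^ 2 ≤
      16 * (∫⁻ y, ‖(u - w) ((1 - ε) • x + ε • y)‖ₑ ^ 2 ∂ν) +
        (16 * ENNReal.ofReal η ^ 2 + 16 * ‖(u - w) x‖ₑ ^ 2) := by
    intro x hx
    refine (enorm_average_sub_sq_le hM hν hu hu2 hε0.ne' x).trans ?_
    calc ∫⁻ y, ‖u ((1 - ε) • x + ε • y) - u x‖ₑ ^ 2 ∂ν ≤
        ∫⁻ y, (16 * ‖(u - w) ((1 - ε) • x + ε • y)‖ₑ ^ 2 +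
          (16 * ENNReal.ofReal η ^ 2 + 16 * ‖(u - w) x‖ₑ ^ 2)) ∂ν := by
          refine lintegral_mono_ae ?_
          filter_upwards [hνK] with y hy
          set z := (1 - ε) • x + ε • y with hz
          have hzx : dist z x < d := by
            have : z - x = ε • (y - x) := by rw [hz, sub_smul, one_smul, smul_sub]; abel
            rw [dist_eq_norm, this, norm_smul, Real.norm_of_nonneg hε0.le, ← dist_eq_norm]
            refine lt_of_le_of_lt ?_ hε2
            gcongr
            exact (hD hy hx).trans ((le_abs_self D).trans (by linarith))
          have hwe : ‖w z - w x‖ₑ ≤ ENNReal.ofReal η := by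
            rw [← edist_eq_enorm_sub, edist_dist]
            exact ENNReal.ofReal_le_ofReal (hwd hzx).le
          have h1 : u z - u x = ((u - w) z + (w z - w x)) + -((u - w) x) := by
            simp only [Pi.sub_apply]; abel
          have h2 : ‖u z - u x‖ₑ ≤ ‖(u - w) z‖ₑ + ENNReal.ofReal η + ‖(u - w) x‖ₑ := by
            rw [h1]
            refine (enorm_add_le _ _).trans ?_
            rw [enorm_neg]
            gcongr
            refine (enorm_add_le _ _).trans ?_
            gcongr
          calc ‖u z - u x‖ₑ ^ 2 ≤ (‖(u - w) z‖ₑ + ENNReal.ofReal η + ‖(u - w) x‖ₑ) ^ 2 := by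
                gcongr
            _ ≤ 4 * (4 * (‖(u - w) z‖ₑ ^ 2 + ENNReal.ofReal η ^ 2) + 4 * ‖(u - w) x‖ₑ ^ 2) := by
                refine (ENNReal.add_sq_le_four_mul _ _).trans ?_
                gcongr
                · exact ENNReal.add_sq_le_four_mul _ _
                · exact le_mul_of_one_le_left zero_le (by norm_num)
            _ = _ := by ring
      _ = _ := by
          rw [lintegral_add_right _ measurable_const, lintegral_const_mul' _ _ (by simp)]
          simp
  have hswap : ∫⁻ x in K, ∫⁻ y, ‖(u - w) ((1 - ε) • x + ε • y)‖ₑ ^ 2 ∂ν ≤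
      4 * ENNReal.ofReal η ^ 2 := by
    rw [lintegral_lintegral_swap hm2.aemeasurable]
    calc _ ≤ ∫⁻ y, 4 * ENNReal.ofReal η ^ 2 ∂ν := by
          refine lintegral_mono fun y => ?_
          refine (setLIntegral_comp_affine_le hm1 hK MeasurableSet.univ (s := 1 - ε)
            (by linarith) (b := ε • y) fun _ _ => mem_univ _).trans ?_
          rw [setLIntegral_univ]
          gcongr
      _ = _ := by simp
  calc _ ≤ ∫⁻ x in K, (16 * (∫⁻ y, ‖(u - w) ((1 - ε) • x + ε • y)‖ₑ ^ 2 ∂ν) +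
        (16 * ENNReal.ofReal η ^ 2 + 16 * ‖(u - w) x‖ₑ ^ 2)) :=
        setLIntegral_mono' hK hpt
    _ = 16 * (∫⁻ x in K, ∫⁻ y, ‖(u - w) ((1 - ε) • x + ε • y)‖ₑ ^ 2 ∂ν) +
        (16 * ENNReal.ofReal η ^ 2 * volume K + 16 * ∫⁻ x in K, ‖(u - w) x‖ₑ ^ 2) := by
        have hm3 : Measurable fun x => 16 * ENNReal.ofReal η ^ 2 + 16 * ‖(u - w) x‖ₑ ^ 2 :=
          (hm1.const_mul _).const_add _
        rw [lintegral_add_right _ hm3,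
          lintegral_const_mul' _ _ (by simp), lintegral_add_left measurable_const,
          setLIntegral_const, lintegral_const_mul' _ _ (by simp)]
    _ ≤ 16 * (4 * ENNReal.ofReal η ^ 2) +
        (16 * ENNReal.ofReal η ^ 2 * volume K + 16 * ENNReal.ofReal η ^ 2) := by
        gcongr
        exact (setLIntegral_le_lintegral _ _).trans hwu2
    _ = (80 + 16 * volume K) * ENNReal.ofReal η ^ 2 := by ring
    _ ≤ δ := hηδ

end Averaging

open scoped Convolution

namespace StarBall

variable {K : Set Plane} {c : Plane} {r : ℝ}

/-- A bump function supported in the ball. -/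
noncomputable def bump (h : StarBall K c r) : ContDiffBump c where
  rIn := r / 4
  rOut := r / 2
  rIn_pos := by have := h.pos; positivity
  rIn_lt_rOut := by have := h.pos; linarith

/-- A smooth probability density supported in the ball. -/
noncomputable def density (h : StarBall K c r) : Plane → ℝ := h.bump.normed volume

/-- The probability measure with density `density`. -/
noncomputable def densityMeasure (h : StarBall K c r) : Measure Plane :=
  volume.withDensity fun y => ENNReal.ofReal (h.density y)

lemma contDiff_density (h : StarBall K c r) : ContDiff ℝ ∞ h.density := h.bump.contDiff_normed

lemma density_nonneg (h : StarBall K c r) (y : Plane) : 0 ≤ h.density y := h.bump.nonneg_normed y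

lemma support_density (h : StarBall K c r) :
    Function.support h.density ⊆ Metric.closedBall c (r / 2) :=
  (h.bump.support_normed_eq (μ := volume)).subset.trans Metric.ball_subset_closedBall

lemma closedBall_half_subset (h : StarBall K c r) :
    Metric.closedBall c (r / 2) ⊆ Metric.ball c r :=
  Metric.closedBall_subset_ball (half_lt_self h.pos)

lemma measurable_ofReal_density (h : StarBall K c r) :
    Measurable fun y => ENNReal.ofReal (h.density y) :=
  (ENNReal.continuous_ofReal.comp h.contDiff_density.continuous).measurable

instance (h : StarBall K c r) : IsProbabilityMeasure h.densityMeasure where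
  measure_univ := by
    rw [densityMeasure, withDensity_apply _ MeasurableSet.univ, setLIntegral_univ, density,
      ← ofReal_integral_eq_lintegral_ofReal h.bump.integrable_normed
        (ae_of_all _ h.density_nonneg), h.bump.integral_normed, ENNReal.ofReal_one]

lemma densityMeasure_le (h : StarBall K c r) :
    ∃ M : ℝ≥0∞, M ≠ ⊤ ∧ h.densityMeasure ≤ M • volume := by
  refine ⟨ENNReal.ofReal (1 / volume.real (Metric.closedBall c (r / 4))), ENNReal.ofReal_ne_top,
    ?_⟩
  rw [← withDensity_const]
  refine withDensity_mono (ae_of_all _ fun y => ENNReal.ofReal_le_ofReal ?_)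
  exact h.bump.normed_le_div_measure_closedBall_rIn volume y

lemma ae_densityMeasure_mem (h : StarBall K c r) : ∀ᵐ y ∂h.densityMeasure, y ∈ K := by
  rw [densityMeasure, ae_withDensity_iff h.measurable_ofReal_density]
  refine ae_of_all _ fun y hy => h.ball_subset (h.closedBall_half_subset (h.support_density ?_))
  intro h0
  exact hy (by simp [h0])

/-- The convolution kernel of the averaging operator. -/
noncomputable def kernel (h : StarBall K c r) (ε : ℝ) (w : Plane) : ℝ :=
  (ε ^ 2)⁻¹ * h.density (-(ε⁻¹ • w))

lemma contDiff_kernel (h : StarBall K c r) (ε : ℝ) : ContDiff ℝ ∞ (h.kernel ε) :=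
  contDiff_const.mul (h.contDiff_density.comp (contDiff_id.const_smul ε⁻¹).neg)

lemma support_kernel_subset (h : StarBall K c r) {ε : ℝ} (hε : 0 < ε) (z : Plane) :
    Function.support (fun t => h.kernel ε (z - t)) ⊆
      (fun y => z + ε • y) '' Metric.closedBall c (r / 2) := by
  intro t ht
  refine ⟨-(ε⁻¹ • (z - t)), h.support_density fun h0 => ht ?_, ?_⟩
  · simp [kernel, h0]
  · simp [smul_smul, hε.ne']

lemma isCompact_kernel_image (z : Plane) (ε : ℝ) :
    IsCompact ((fun y => z + ε • y) '' Metric.closedBall c (r / 2)) :=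
  (isCompact_closedBall c (r / 2)).image (by fun_prop)

lemma hasCompactSupport_kernel_sub (h : StarBall K c r) {ε : ℝ} (hε : 0 < ε) (z : Plane) :
    HasCompactSupport fun t => h.kernel ε (z - t) :=
  HasCompactSupport.of_support_subset_isCompact (isCompact_kernel_image z ε)
    (h.support_kernel_subset hε z)

lemma hasCompactSupport_kernel (h : StarBall K c r) {ε : ℝ} (hε : 0 < ε) :
    HasCompactSupport (h.kernel ε) := by
  have := (h.hasCompactSupport_kernel_sub hε 0).comp_homeomorph (Homeomorph.neg Plane)
  simpa [Function.comp_def] using this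

/-- The substitution `t = z + ε y` moves the dependence on `z` from `u` to a smooth kernel. -/
lemma integral_average_eq (h : StarBall K c r) {E : Type*} [NormedAddCommGroup E]
    [NormedSpace ℝ E] (u : Plane → E) {ε : ℝ} (hε : 0 < ε) (z : Plane) :
    ∫ y, u (z + ε • y) ∂h.densityMeasure = ∫ t, h.kernel ε (z - t) • u t := by
  rw [densityMeasure, integral_withDensity_eq_integral_toReal_smul h.measurable_ofReal_density
    (ae_of_all _ fun _ => ENNReal.ofReal_lt_top)]
  have h1 := Measure.integral_comp_smul volume
    (fun t => h.kernel ε (z - (z + t)) • u (z + t)) ε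
  rw [integral_add_left_eq_self (fun t => h.kernel ε (z - t) • u t) z, finrank_euclideanSpace,
    Fintype.card_fin, abs_of_pos (by positivity), eq_inv_smul_iff₀ (by positivity),
    ← integral_smul] at h1
  rw [← h1]
  refine integral_congr_ae (ae_of_all _ fun y => ?_)
  simp only [kernel]
  rw [ENNReal.toReal_ofReal (h.density_nonneg y), smul_smul, ← mul_assoc,
    mul_inv_cancel₀ (by positivity), one_mul, sub_add_cancel_left, smul_neg, neg_neg, smul_smul,
    inv_mul_cancel₀ hε.ne', one_smul]

/-- This is the gain over plain mollification: contracting towards the ball keeps the kernel inside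
`K` even for boundary points `x`, so no extension of functions across the boundary is required. -/
lemma tsupport_kernel_sub_subset (h : StarBall K c r) {ε : ℝ} (hε : 0 < ε) (hε1 : ε ≤ 1)
    {x : Plane} (hx : x ∈ closure K) :
    tsupport (fun t => h.kernel ε ((1 - ε) • x - t)) ⊆ K := by
  refine (closure_minimal (h.support_kernel_subset hε _)
    (isCompact_kernel_image _ ε).isClosed).trans ?_
  rintro _ ⟨y, hy, rfl⟩
  exact h.combo_mem hx (h.closedBall_half_subset hy) hε hε1

/-- The average of `u` over the points `(1 - ε) x + ε y`, `y` in the ball. -/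
noncomputable def average (h : StarBall K c r) {E : Type*} [NormedAddCommGroup E]
    [NormedSpace ℝ E] (ε : ℝ) (u : Plane → E) (x : Plane) : E :=
  ∫ y, u ((1 - ε) • x + ε • y) ∂h.densityMeasure

lemma average_eq_convolution (h : StarBall K c r) (u : Plane → ℝ) {ε : ℝ} (hε : 0 < ε) :
    h.average ε u = fun x => (u ⋆[ContinuousLinearMap.mul ℝ ℝ, volume] h.kernel ε) ((1 - ε) • x) := by
  ext x
  rw [average, h.integral_average_eq u hε, convolution_def]
  simp [mul_comm]

lemma contDiff_average (h : StarBall K c r) {u : Plane → ℝ} (hu : LocallyIntegrable u) {ε : ℝ}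
    (hε : 0 < ε) : ContDiff ℝ ∞ (h.average ε u) := by
  rw [h.average_eq_convolution u hε]
  exact ((h.hasCompactSupport_kernel hε).contDiff_convolution_right _ hu
    (h.contDiff_kernel ε)).comp (contDiff_id.const_smul (1 - ε))

lemma fderiv_average (h : StarBall K c r) {u : Plane → ℝ} (hu : LocallyIntegrable u) {ε : ℝ}
    (hε : 0 < ε) (x e : Plane) : fderiv ℝ (h.average ε u) x e =
      (1 - ε) * ∫ t, u t * fderiv ℝ (h.kernel ε) ((1 - ε) • x - t) e := by
  have h1 := (h.hasCompactSupport_kernel hε).hasFDerivAt_convolution_right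
    (ContinuousLinearMap.mul ℝ ℝ) hu ((h.contDiff_kernel ε).of_le (by simp)) ((1 - ε) • x)
  have h2 : HasFDerivAt (fun x : Plane => (1 - ε) • x)
      ((1 - ε) • ContinuousLinearMap.id ℝ Plane) x := (hasFDerivAt_id x).const_smul (1 - ε)
  have h3 := (h1.comp x h2).fderiv
  rw [h.average_eq_convolution u hε]
  change fderiv ℝ ((u ⋆[ContinuousLinearMap.mul ℝ ℝ, volume] h.kernel ε) ∘
    fun x => (1 - ε) • x) x e = _
  rw [h3]
  simp only [ContinuousLinearMap.comp_apply, _root_.smul_apply,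
    ContinuousLinearMap.id_apply, map_smul, smul_eq_mul]
  rw [convolution_precompR_apply _ hu ((h.hasCompactSupport_kernel hε).fderiv ℝ)
    ((h.contDiff_kernel ε).continuous_fderiv (by simp)), convolution_def]
  rfl

end StarBall

namespace CurvedPolygon

variable {ι : Type*} [Fintype ι] {P : CurvedPolygon ι} {c : Plane} {r : ℝ}

instance : IsFiniteMeasure P.bulkMeasure :=
  ⟨by rw [Measure.restrict_apply_univ]; exact P.bounded.measure_lt_top⟩

lemma isTest_kernel (h : StarBall P.K c r) {ε : ℝ} (hε : 0 < ε) (hε1 : ε ≤ 1) {x : Plane}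
    (hx : x ∈ closure P.K) : P.IsTest fun t => h.kernel ε ((1 - ε) • x - t) :=
  ⟨(h.contDiff_kernel ε).comp (contDiff_const.sub contDiff_id),
    h.hasCompactSupport_kernel_sub hε _, h.tsupport_kernel_sub_subset hε hε1 hx⟩

lemma memLp_indicator {E : Type*} [NormedAddCommGroup E] (v : Lp E 2 P.bulkMeasure) :
    MemLp (P.K.indicator v) 2 :=
  (memLp_indicator_iff_restrict P.isOpen.measurableSet).2 (Lp.memLp v)

/-- The derivative of the average falls on the kernel, which as a function of `t` is a test function
in `K`; the weak gradient of `v` can therefore be tested against it. The sign from differentiating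
in `t` instead of `x` cancels the sign of the weak gradient, and `1 - ε` is the chain rule. -/
lemma HasWeakGradient.gradient_average {v : P.L2} {g : P.L2Vec} (hvg : P.HasWeakGradient v g)
    (h : StarBall P.K c r) {ε : ℝ} (hε : 0 < ε) (hε1 : ε ≤ 1) {x : Plane} (hx : x ∈ P.K) :
    gradient (h.average ε (P.K.indicator v)) x =
      (1 - ε) • h.average ε (P.K.indicator g) x := by
  have hu : LocallyIntegrable (P.K.indicator v) :=
    (memLp_indicator v).locallyIntegrable (by norm_num)
  have hθ := isTest_kernel h hε hε1 (subset_closure hx)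
  set θ : Plane → ℝ := fun t => h.kernel ε ((1 - ε) • x - t) with hθdef
  have h1 := hvg θ hθ
  have h2 : ∫ t in P.K, θ t • g t = h.average ε (P.K.indicator g) x := by
    rw [StarBall.average, h.integral_average_eq _ hε, ← integral_indicator P.isOpen.measurableSet]
    refine integral_congr_ae (ae_of_all _ fun t => ?_)
    by_cases ht : t ∈ P.K <;> simp [ht, hθdef]
  have hint : Integrable (fun x => v x • gradient θ x) P.bulkMeasure :=
    memLp_one_iff_integrable.1 (hθ.memLp_gradient.smul (p := 2) (q := 2) (r := 1) (Lp.memLp v))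
  have h3 : (1 - ε) • h.average ε (P.K.indicator g) x =
      -((1 - ε) • ∫ x in P.K, v x • gradient θ x) := by
    rw [h1, h2, smul_neg, neg_neg]
  rw [h3]
  refine ext_inner_left ℝ fun e => ?_
  rw [inner_neg_right, real_inner_smul_right, ← integral_inner hint, real_inner_comm,
    inner_gradient_left, h.fderiv_average hu hε, ← mul_neg, ← integral_neg,
    ← integral_indicator P.isOpen.measurableSet]
  congr 1
  refine integral_congr_ae (ae_of_all _ fun t => ?_)
  have h4 : fderiv ℝ θ t e = -fderiv ℝ (h.kernel ε) ((1 - ε) • x - t) e := by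
    have h5 : HasFDerivAt (fun t : Plane => (1 - ε) • x - t) (-ContinuousLinearMap.id ℝ Plane) t :=
      (hasFDerivAt_id t).const_sub _
    have h6 := (((h.contDiff_kernel ε).differentiable (by simp))
      ((1 - ε) • x - t)).hasFDerivAt.comp t h5
    have h7 : fderiv ℝ θ t = _ := h6.fderiv
    rw [h7]
    simp
  by_cases ht : t ∈ P.K
  · simp only [indicator_of_mem ht]
    rw [real_inner_smul_right, real_inner_comm, inner_gradient_left, h4]
    ring
  · simp [ht]

/-- Functions which are smooth up to the boundary are dense in `H¹(K)`. -/
lemma HasWeakGradient.exists_smooth_approx {v : P.L2} {g : P.L2Vec}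
    (hvg : P.HasWeakGradient v g) {δ : ℝ≥0∞} (hδ : δ ≠ 0) :
    ∃ φ : Plane → ℝ, ContDiff ℝ ∞ φ ∧ ∫⁻ x in P.K, ‖φ x - v x‖ₑ ^ 2 ≤ δ ∧
      ∫⁻ x in P.K, ‖gradient φ x - g x‖ₑ ^ 2 ≤ δ := by
  obtain ⟨c, r, h⟩ := P.exists_starBall
  obtain ⟨M, hM, hν⟩ := h.densityMeasure_le
  have hKm := P.isOpen.measurableSet
  have hmv : Measurable (P.K.indicator v) := (Lp.stronglyMeasurable v).measurable.indicator hKm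
  have hmg : Measurable (P.K.indicator g) := (Lp.stronglyMeasurable g).measurable.indicator hKm
  have hδ8 : δ / 8 ≠ 0 := (ENNReal.div_pos hδ (by simp)).ne'
  obtain ⟨ε₁, hε₁, h1⟩ := exists_average_sub_le hM hν hKm P.bounded h.ae_densityMeasure_mem hmv
    (memLp_indicator v) hδ
  obtain ⟨ε₂, hε₂, h2⟩ := exists_average_sub_le hM hν hKm P.bounded h.ae_densityMeasure_mem hmg
    (memLp_indicator g) hδ8
  -- The gradient of the average carries the factor `1 - ε`; the third smallness condition controls
  -- the leftover `-ε g`. With the factor 4 in the square of a sum, two errors of `δ / 8` add up to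
  -- `δ`.
  obtain ⟨ε₃, hε₃, h3⟩ := ENNReal.exists_pos_mul_sq_le
    (C := ∫⁻ x in P.K, ‖P.K.indicator g x‖ₑ ^ 2) (δ := δ / 8)
    (by
      rw [← eLpNorm_two_sq]
      exact (ENNReal.pow_lt_top ((memLp_indicator g).restrict _).2).ne) hδ8
  obtain ⟨ε, hε0, hε⟩ := exists_between (lt_min (lt_min hε₁ hε₂) (lt_min hε₃ one_pos))
  obtain ⟨⟨hl1, hl2⟩, hl3, hl4⟩ := by simpa only [lt_min_iff] using hε
  refine ⟨h.average ε (P.K.indicator v),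
    h.contDiff_average ((memLp_indicator v).locallyIntegrable (by norm_num)) hε0, ?_, ?_⟩
  · refine le_trans (le_of_eq ?_) (h1 ε ⟨hε0, hl1⟩)
    refine setLIntegral_congr_fun hKm fun x hx => ?_
    simp only [indicator_of_mem hx]
    rfl
  · have h4 := h2 ε ⟨hε0, hl2⟩
    have h5 : ∀ x ∈ P.K, ‖gradient (h.average ε (P.K.indicator v)) x - g x‖ₑ ^ 2 ≤
        4 * (‖h.average ε (P.K.indicator g) x - P.K.indicator g x‖ₑ ^ 2) +
          4 * (‖P.K.indicator g x‖ₑ ^ 2 * ENNReal.ofReal ε₃ ^ 2) := by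
      intro x hx
      rw [hvg.gradient_average h hε0 hl4.le hx]
      have h6 : (1 - ε) • h.average ε (P.K.indicator g) x - g x =
          (1 - ε) • (h.average ε (P.K.indicator g) x - P.K.indicator g x) +
            (-ε) • P.K.indicator g x := by
        rw [indicator_of_mem hx, smul_sub, sub_smul 1 ε (g x), one_smul, neg_smul]; abel
      have h7 : ‖(1 - ε) • h.average ε (P.K.indicator g) x - g x‖ₑ ≤
          ‖h.average ε (P.K.indicator g) x - P.K.indicator g x‖ₑ +
            ‖P.K.indicator g x‖ₑ * ENNReal.ofReal ε₃ := by
        rw [h6]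
        refine (enorm_add_le _ _).trans ?_
        rw [enorm_smul, enorm_smul, enorm_neg]
        gcongr ?_ + ?_
        · refine mul_le_of_le_one_left zero_le ?_
          rw [Real.enorm_of_nonneg (by linarith), ENNReal.ofReal_le_one]
          linarith
        · rw [mul_comm, Real.enorm_of_nonneg hε0.le]
          gcongr
      refine (pow_le_pow_left₀ zero_le h7 2).trans ((ENNReal.add_sq_le_four_mul _ _).trans ?_)
      rw [mul_add, mul_pow]
    refine (setLIntegral_mono' hKm h5).trans ?_
    have hm : Measurable fun x => ‖P.K.indicator g x‖ₑ ^ 2 := hmg.enorm.pow_const 2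
    rw [lintegral_add_right _ ((hm.mul_const _).const_mul _), lintegral_const_mul' _ _ (by simp),
      lintegral_const_mul' _ _ (by simp), lintegral_mul_const _ hm]
    calc _ ≤ 4 * (δ / 8) + 4 * (δ / 8) := by gcongr; exact h4
      _ = δ := by
        rw [← add_mul, show (4 : ℝ≥0∞) + 4 = 8 by norm_num,
          ENNReal.mul_div_cancel (by norm_num) (by norm_num)]

end CurvedPolygon

/-! ### Norms in `L²` and the measures on the element and its boundary. -/

lemma norm_le_sqrt_mul_of_enorm_sq_le {E F : Type*} [SeminormedAddCommGroup E]
    [SeminormedAddCommGroup F] {a : E} {b : F} {C : ℝ≥0∞} (hC : C ≠ ⊤)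
    (h : ‖a‖ₑ ^ 2 ≤ C * ‖b‖ₑ ^ 2) : ‖a‖ ≤ √C.toReal * ‖b‖ := by
  have h1 := ENNReal.toReal_mono (ENNReal.mul_ne_top hC (ENNReal.pow_ne_top enorm_ne_top)) h
  rw [ENNReal.toReal_mul, ENNReal.toReal_pow, ENNReal.toReal_pow, toReal_enorm, toReal_enorm] at h1
  refine le_of_sq_le_sq ?_ (by positivity)
  rwa [mul_pow, Real.sq_sqrt ENNReal.toReal_nonneg]

lemma MeasureTheory.Lp.enorm_two_sq {α E : Type*} [MeasurableSpace α] {μ : Measure α}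
    [NormedAddCommGroup E] (u : Lp E 2 μ) : ‖u‖ₑ ^ 2 = ∫⁻ x, ‖u x‖ₑ ^ 2 ∂μ := by
  rw [Lp.enorm_def, eLpNorm_two_sq]

lemma MeasureTheory.MemLp.enorm_toLp_sub_sq {α E : Type*} [MeasurableSpace α] {μ : Measure α}
    [NormedAddCommGroup E] {f : α → E} (hf : MemLp f 2 μ) (u : Lp E 2 μ) :
    ‖hf.toLp f - u‖ₑ ^ 2 = ∫⁻ x, ‖f x - u x‖ₑ ^ 2 ∂μ := by
  rw [Lp.enorm_two_sq]
  refine lintegral_congr_ae ?_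
  filter_upwards [Lp.coeFn_sub (hf.toLp f) u, hf.coeFn_toLp] with x h1 h2
  rw [h1, Pi.sub_apply, h2]

lemma MeasureTheory.MemLp.enorm_toLp_sq {α E : Type*} [MeasurableSpace α] {μ : Measure α}
    [NormedAddCommGroup E] {f : α → E} (hf : MemLp f 2 μ) :
    ‖hf.toLp f‖ₑ ^ 2 = ∫⁻ x, ‖f x‖ₑ ^ 2 ∂μ := by
  rw [Lp.enorm_toLp, eLpNorm_two_sq]

lemma WithLp.prod_enorm_sq_eq_of_L2 {α β : Type*} [SeminormedAddCommGroup α]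
    [SeminormedAddCommGroup β] (x : WithLp 2 (α × β)) :
    ‖x‖ₑ ^ 2 = ‖x.fst‖ₑ ^ 2 + ‖x.snd‖ₑ ^ 2 := by
  simp only [← ofReal_norm]
  rw [← ENNReal.ofReal_pow (norm_nonneg _), WithLp.prod_norm_sq_eq_of_L2,
    ENNReal.ofReal_add (by positivity) (by positivity), ENNReal.ofReal_pow (norm_nonneg _),
    ENNReal.ofReal_pow (norm_nonneg _)]

lemma memLp_of_continuous_of_compact {E : Type*} [NormedAddCommGroup E] {μ : Measure Plane}
    [IsFiniteMeasure μ] {S : Set Plane} (hS : IsCompact S) (hμ : ∀ᵐ x ∂μ, x ∈ S) {f : Plane → E}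
    (hf : Continuous f) {p : ℝ≥0∞} : MemLp f p μ := by
  obtain ⟨C, hC⟩ := hS.exists_bound_of_continuousOn hf.continuousOn
  refine MemLp.of_bound hf.aestronglyMeasurable C ?_
  filter_upwards [hμ] with x hx using hC x hx

namespace CurvedPolygon

variable {ι : Type*} [Fintype ι] {P : CurvedPolygon ι}

variable (P) in
lemma isCompact_closure : IsCompact (closure P.K) :=
  Metric.isCompact_of_isClosed_isBounded isClosed_closure P.bounded.closure

lemma memLp_bulk {E : Type*} [NormedAddCommGroup E] {f : Plane → E} (hf : Continuous f)
    {p : ℝ≥0∞} : MemLp f p P.bulkMeasure :=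
  memLp_of_continuous_of_compact P.isCompact_closure
    ((ae_restrict_mem P.isOpen.measurableSet).mono fun _ hx => subset_closure hx) hf

instance (e : ι) : IsFiniteMeasure (P.edgeMeasure e) := by
  have h : IsFiniteMeasure ((volume.restrict (Icc (P.a e) (P.b e))).withDensity fun t =>
      ENNReal.ofReal ‖derivWithin (P.γ e) (Icc (P.a e) (P.b e)) t‖) := by
    refine isFiniteMeasure_withDensity_ofReal ?_
    exact ((P.continuousOn_derivWithin_γ e).norm.integrableOn_Icc).2
  rw [edgeMeasure]
  infer_instance

instance : IsFiniteMeasure P.bdryMeasure := by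
  rw [bdryMeasure]
  infer_instance

/-- By regularity the density `‖γ'‖` vanishes nowhere, so null sets for arc length and for the
parameter correspond in both directions. -/
lemma ae_edgeMeasure_iff (e : ι) {p : Plane → Prop} (hp : MeasurableSet {x | p x}) :
    (∀ᵐ x ∂P.edgeMeasure e, p x) ↔
      ∀ᵐ t ∂volume.restrict (Ioo (P.a e) (P.b e)), p (P.γ e t) := by
  have h1 := (P.aemeasurable_γ e).mono_ac (withDensity_absolutelyContinuous _ fun t =>
    ENNReal.ofReal ‖derivWithin (P.γ e) (Icc (P.a e) (P.b e)) t‖)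
  rw [edgeMeasure, ae_map_iff h1 hp,
    ae_withDensity_iff' (P.aemeasurable_enorm_derivWithin_γ e), restrict_Ioo_eq_restrict_Icc]
  refine eventually_congr ?_
  filter_upwards [ae_restrict_mem measurableSet_Icc] with t ht
  have : ENNReal.ofReal ‖derivWithin (P.γ e) (Icc (P.a e) (P.b e)) t‖ ≠ 0 := by
    rw [Ne, ENNReal.ofReal_eq_zero, not_le, norm_pos_iff]
    exact P.regular e t ht
  simp only [ne_eq, this, not_false_eq_true, true_imp_iff]

lemma ae_edgeMeasure_mem_frontier (e : ι) : ∀ᵐ x ∂P.edgeMeasure e, x ∈ frontier P.K := by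
  refine (P.ae_edgeMeasure_iff e (p := (· ∈ frontier P.K)) isClosed_frontier.measurableSet).2 ?_
  filter_upwards [ae_restrict_mem measurableSet_Ioo] with t ht
  exact P.γ_mem_frontier e (Ioo_subset_Icc_self ht)

lemma ae_bdryMeasure_iff {p : Plane → Prop} :
    (∀ᵐ x ∂P.bdryMeasure, p x) ↔ ∀ e, ∀ᵐ x ∂P.edgeMeasure e, p x := by
  simp only [ae_iff, bdryMeasure, Measure.finsetSum_apply, Finset.sum_eq_zero_iff,
    Finset.mem_univ, true_implies]

variable (P) in
lemma ae_bdryMeasure_mem_frontier : ∀ᵐ x ∂P.bdryMeasure, x ∈ frontier P.K :=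
  ae_bdryMeasure_iff.2 ae_edgeMeasure_mem_frontier

lemma memLp_bdry {E : Type*} [NormedAddCommGroup E] {f : Plane → E} (hf : Continuous f)
    {p : ℝ≥0∞} : MemLp f p P.bdryMeasure :=
  memLp_of_continuous_of_compact P.isCompact_closure
    (P.ae_bdryMeasure_mem_frontier.mono fun _ hx => frontier_subset_closure hx) hf

/-! ### The Sobolev space -/

/-- The difference of two weak gradients annihilates all test functions, so the fundamental lemma of
the calculus of variations applies. -/
lemma HasWeakGradient.unique {v : P.L2} {g g' : P.L2Vec} (h : P.HasWeakGradient v g)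
    (h' : P.HasWeakGradient v g') : g = g' := by
  have hloc : LocallyIntegrableOn (fun x => g x - g' x) P.K volume := by
    have : IntegrableOn (fun x => g x - g' x) P.K volume :=
      (((Lp.memLp g).sub (Lp.memLp g')).integrable (by norm_num))
    exact this.locallyIntegrableOn
  have hz := P.isOpen.ae_eq_zero_of_integral_contDiff_smul_eq_zero hloc fun φ h1 h2 h3 => by
    have hφ : P.IsTest φ := ⟨h1, h2, h3⟩
    have i (u : P.L2Vec) : Integrable (fun x => φ x • u x) P.bulkMeasure :=
      memLp_one_iff_integrable.1 ((Lp.memLp u).smul (p := 2) (q := 2) (r := 1) hφ.memLp)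
    rw [← setIntegral_eq_integral_of_forall_compl_eq_zero (s := P.K)]
    · simp only [smul_sub]
      rw [integral_sub (i g) (i g'), sub_eq_zero]
      exact neg_injective ((h φ hφ).symm.trans (h' φ hφ))
    · intro x hx
      rw [image_eq_zero_of_notMem_tsupport fun hx' => hx (h3 hx'), zero_smul]
  refine Lp.ext ?_
  rw [EventuallyEq, ae_restrict_iff' P.isOpen.measurableSet]
  filter_upwards [hz] with x hx hxK
  exact sub_eq_zero.1 (hx hxK)

/-- Taking components along fixed vectors `e` turns each test condition into an equality of inner
products with fixed `L²` elements, which survives limits. The completeness of `sobolev` rests on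
this. -/
lemma hasWeakGradient_iff_inner {v : P.L2} {g : P.L2Vec} : P.HasWeakGradient v g ↔
    ∀ (φ : Plane → ℝ) (hφ : P.IsTest φ) (e : Plane),
      inner ℝ (hφ.memLp_gradient.const_inner e).toLp v =
        -inner ℝ (MemLp.toLp (fun x => φ x • e)
          (((hφ.1.continuous.smul continuous_const).memLp_of_hasCompactSupport
            hφ.2.1.smul_right))) g := by
  refine forall_congr' fun φ => forall_congr' fun hφ => ?_
  have i1 : Integrable (fun x => v x • gradient φ x) P.bulkMeasure :=
    memLp_one_iff_integrable.1 (hφ.memLp_gradient.smul (p := 2) (q := 2) (r := 1) (Lp.memLp v))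
  have i2 : Integrable (fun x => φ x • g x) P.bulkMeasure :=
    memLp_one_iff_integrable.1 ((Lp.memLp g).smul (p := 2) (q := 2) (r := 1) hφ.memLp)
  rw [ext_iff_inner_left ℝ]
  refine forall_congr' fun e => ?_
  rw [inner_neg_right, ← integral_inner i1, ← integral_inner i2, L2.inner_def, L2.inner_def]
  have hi : MemLp (fun x => inner ℝ e (gradient φ x)) 2 P.bulkMeasure :=
    hφ.memLp_gradient.const_inner e
  have h1 : ∫ x in P.K, inner ℝ ((hi.toLp : P.L2) x) (v x) =
      ∫ x in P.K, inner ℝ e (v x • gradient φ x) := by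
    refine integral_congr_ae ?_
    filter_upwards [hi.coeFn_toLp] with x hx
    rw [hx, real_inner_smul_right]
    simp
  have hm : MemLp (fun x => φ x • e) 2 P.bulkMeasure :=
    (hφ.1.continuous.smul continuous_const).memLp_of_hasCompactSupport hφ.2.1.smul_right
  have h2 : ∫ x in P.K, inner ℝ ((hm.toLp : P.L2Vec) x) (g x) =
      ∫ x in P.K, inner ℝ e (φ x • g x) := by
    refine integral_congr_ae ?_
    filter_upwards [hm.coeFn_toLp] with x hx
    rw [hx, real_inner_smul_right, real_inner_smul_left]
  rw [h1, h2]

variable (P) in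
/-- The Sobolev space `H¹(K)`, realized as the space of pairs of a function and its weak
gradient. -/
noncomputable def sobolev : Submodule ℝ (WithLp 2 (P.L2 × P.L2Vec)) where
  carrier := {x | P.HasWeakGradient x.fst x.snd}
  zero_mem' := hasWeakGradient_zero
  add_mem' h h' := h.add h'
  smul_mem' c _ h := h.smul c

variable (P) in
lemma isClosed_sobolev : IsClosed (P.sobolev : Set (WithLp 2 (P.L2 × P.L2Vec))) := by
  have h1 : (P.sobolev : Set (WithLp 2 (P.L2 × P.L2Vec))) =
      {x | P.HasWeakGradient x.fst x.snd} := rfl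
  simp only [h1, hasWeakGradient_iff_inner, ofPred_forall]
  refine isClosed_iInter fun φ => isClosed_iInter fun hφ => isClosed_iInter fun e => ?_
  refine isClosed_eq ?_ ?_
  · exact continuous_const.inner (WithLp.fstL 2 ℝ P.L2 P.L2Vec).continuous
  · exact (continuous_const.inner (WithLp.sndL 2 ℝ P.L2 P.L2Vec).continuous).neg

instance : CompleteSpace P.sobolev := P.isClosed_sobolev.completeSpace_coe

variable (P) in
/-- The function underlying an element of the Sobolev space. -/
noncomputable def val : P.sobolev →L[ℝ] P.L2 := (WithLp.fstL 2 ℝ P.L2 P.L2Vec).comp P.sobolev.subtypeL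

variable (P) in
/-- The weak gradient of an element of the Sobolev space. -/
noncomputable def grad : P.sobolev →L[ℝ] P.L2Vec :=
  (WithLp.sndL 2 ℝ P.L2 P.L2Vec).comp P.sobolev.subtypeL

lemma hasWeakGradient_val (x : P.sobolev) : P.HasWeakGradient (P.val x) (P.grad x) := x.2

lemma sobolev_enorm_sq (x : P.sobolev) : ‖x‖ₑ ^ 2 = ‖P.val x‖ₑ ^ 2 + ‖P.grad x‖ₑ ^ 2 :=
  WithLp.prod_enorm_sq_eq_of_L2 x.1

lemma sobolev_norm_sq (x : P.sobolev) : ‖x‖ ^ 2 = ‖P.val x‖ ^ 2 + ‖P.grad x‖ ^ 2 :=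
  WithLp.prod_norm_sq_eq_of_L2 x.1

/-- The element of the Sobolev space given by a function with a weak gradient. -/
noncomputable def HasWeakGradient.toSobolev {v : P.L2} {g : P.L2Vec} (h : P.HasWeakGradient v g) :
    P.sobolev := ⟨WithLp.toLp 2 (v, g), h⟩

@[simp] lemma HasWeakGradient.grad_toSobolev {v : P.L2} {g : P.L2Vec}
    (h : P.HasWeakGradient v g) : P.grad h.toSobolev = g := rfl

lemma sobolev_ext {x y : P.sobolev} (h : P.val x = P.val y) (h' : P.grad x = P.grad y) : x = y := by
  have h0 : ‖x - y‖ ^ 2 = 0 := by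
    rw [sobolev_norm_sq, map_sub, map_sub, h, h', sub_self, sub_self]; simp
  exact sub_eq_zero.1 (norm_eq_zero.1 (pow_eq_zero_iff (by norm_num) |>.1 h0))

lemma val_injective : Function.Injective P.val := fun x y h =>
  sobolev_ext h ((hasWeakGradient_val x).unique (h ▸ hasWeakGradient_val y))

lemma tendsto_sobolev_iff {α : Type*} {l : Filter α} {f : α → P.sobolev} {x : P.sobolev} :
    Tendsto f l (𝓝 x) ↔ Tendsto (fun n => P.val (f n)) l (𝓝 (P.val x)) ∧
      Tendsto (fun n => P.grad (f n)) l (𝓝 (P.grad x)) := by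
  refine ⟨fun h => ⟨(P.val.continuous.tendsto x).comp h, (P.grad.continuous.tendsto x).comp h⟩,
    fun ⟨h1, h2⟩ => ?_⟩
  rw [tendsto_subtype_rng]
  have h3 := (WithLp.prodContinuousLinearEquiv 2 ℝ P.L2 P.L2Vec).symm.continuous.tendsto
    (P.val x, P.grad x)
  exact h3.comp (h1.prodMk_nhds h2)

/-! ### Smooth functions -/

/-- Smooth functions on the plane. -/
def smooth : Submodule ℝ (Plane → ℝ) where
  carrier := {φ | ContDiff ℝ ∞ φ}
  zero_mem' := (contDiff_const : ContDiff ℝ ∞ fun _ : Plane => (0 : ℝ))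
  add_mem' {φ ψ} (h : ContDiff ℝ ∞ φ) (h' : ContDiff ℝ ∞ ψ) := h.add h'
  smul_mem' c φ (h : ContDiff ℝ ∞ φ) := h.const_smul c

lemma contDiff_smooth (φ : smooth) : ContDiff ℝ ∞ φ.1 := φ.2

lemma memLp_gradient_smooth (φ : smooth) : MemLp (gradient φ.1) 2 P.bulkMeasure :=
  memLp_bulk (continuous_gradient ((contDiff_smooth φ).of_le (by simp)))

lemma memLp_smooth (φ : smooth) : MemLp φ.1 2 P.bulkMeasure := memLp_bulk (contDiff_smooth φ).continuous

lemma memLp_bdry_smooth (φ : smooth) : MemLp φ.1 2 P.bdryMeasure := memLp_bdry (contDiff_smooth φ).continuous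

/-- The test function has compact support in `K`, so the integrals extend to the whole plane, where
integration by parts has no boundary term. -/
lemma hasWeakGradient_smooth (φ : smooth) :
    P.HasWeakGradient (memLp_smooth φ).toLp (memLp_gradient_smooth φ).toLp := by
  intro θ hθ
  have hd : Differentiable ℝ φ.1 := (contDiff_smooth φ).differentiable (by simp)
  have hd' : Differentiable ℝ θ := hθ.1.differentiable (by simp)
  have hg : Continuous (gradient θ) := continuous_gradient (hθ.1.of_le (by simp))
  have hgφ : Continuous (gradient φ.1) := continuous_gradient ((contDiff_smooth φ).of_le (by simp))
  have hgs : HasCompactSupport (gradient θ) := by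
    have h2 : HasCompactSupport (fderiv ℝ θ) := hθ.2.1.fderiv ℝ
    exact h2.comp_left (g := (InnerProductSpace.toDual ℝ Plane).symm) (map_zero _)
  have i1 : Integrable fun x => φ.1 x • gradient θ x :=
    ((contDiff_smooth φ).continuous.smul hg).integrable_of_hasCompactSupport hgs.smul_left
  have i2 : Integrable fun x => θ x • gradient φ.1 x :=
    (hθ.1.continuous.smul hgφ).integrable_of_hasCompactSupport hθ.2.1.smul_right
  have h1 : ∫ x in P.K, ((memLp_smooth φ).toLp : P.L2) x • gradient θ x =
      ∫ x, φ.1 x • gradient θ x := by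
    refine Eq.trans ?_ (setIntegral_eq_integral_of_forall_compl_eq_zero (s := P.K) ?_)
    · refine integral_congr_ae ?_
      filter_upwards [(memLp_smooth (P := P) φ).coeFn_toLp] with x hx
      rw [hx]
    · intro x hx
      have : fderiv ℝ θ x = 0 := image_eq_zero_of_notMem_tsupport
        (f := fderiv ℝ θ) fun h => hx (hθ.2.2 (tsupport_fderiv_subset ℝ h))
      rw [gradient, this, map_zero, smul_zero]
  have h2 : ∫ x in P.K, θ x • ((memLp_gradient_smooth φ).toLp : P.L2Vec) x =
      ∫ x, θ x • gradient φ.1 x := by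
    refine Eq.trans ?_ (setIntegral_eq_integral_of_forall_compl_eq_zero (s := P.K) ?_)
    · refine integral_congr_ae ?_
      filter_upwards [(memLp_gradient_smooth (P := P) φ).coeFn_toLp] with x hx
      rw [hx]
    · intro x hx
      rw [image_eq_zero_of_notMem_tsupport fun h => hx (hθ.2.2 h), zero_smul]
  rw [h1, h2]
  refine ext_inner_left ℝ fun e => ?_
  rw [inner_neg_right, ← integral_inner i1, ← integral_inner i2]
  have h3 := integral_mul_fderiv_eq_neg_fderiv_mul_of_integrable (μ := (volume : Measure Plane))
    (f := φ.1) (g := θ) (v := e) ?_ ?_ ?_ (fun x _ => hd x) (fun x _ => hd' x)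
  · have h4 (ψ : Plane → ℝ) (c : ℝ) (x : Plane) :
        inner ℝ e (c • gradient ψ x) = c * fderiv ℝ ψ x e := by
      rw [real_inner_smul_right, real_inner_comm, inner_gradient_left]
    simp only [h4]
    rw [h3]
    simp only [mul_comm]
  · refine Continuous.integrable_of_hasCompactSupport ?_ hθ.2.1.mul_left
    exact (((contDiff_smooth φ).continuous_fderiv (by simp)).clm_apply continuous_const).mul hθ.1.continuous
  · refine Continuous.integrable_of_hasCompactSupport ?_ ?_
    · exact (contDiff_smooth φ).continuous.mul ((hθ.1.continuous_fderiv (by simp)).clm_apply continuous_const)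
    · exact ((hθ.2.1.fderiv ℝ).comp_left (g := fun L : Plane →L[ℝ] ℝ => L e) rfl).mul_left
  · exact ((contDiff_smooth φ).continuous.mul hθ.1.continuous).integrable_of_hasCompactSupport hθ.2.1.mul_left

lemma gradient_add_smooth (φ ψ : smooth) :
    gradient (φ + ψ).1 = gradient φ.1 + gradient ψ.1 := by
  ext1 x
  have h1 : fderiv ℝ (φ + ψ).1 x = fderiv ℝ φ.1 x + fderiv ℝ ψ.1 x :=
    fderiv_add (((contDiff_smooth φ).differentiable (by simp)) x) (((contDiff_smooth ψ).differentiable (by simp)) x)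
  simp only [gradient, Pi.add_apply, h1, map_add]

lemma gradient_smul_smooth (c : ℝ) (φ : smooth) : gradient (c • φ).1 = c • gradient φ.1 := by
  ext1 x
  have h1 : fderiv ℝ (c • φ).1 x = c • fderiv ℝ φ.1 x :=
    fderiv_const_smul (((contDiff_smooth φ).differentiable (by simp)) x) c
  rw [gradient, h1, map_smulₛₗ]
  rfl

variable (P) in
/-- The inclusion of the smooth functions into the Sobolev space. -/
noncomputable def smoothToSobolev : smooth →ₗ[ℝ] P.sobolev where
  toFun φ := (hasWeakGradient_smooth φ).toSobolev
  map_add' φ ψ := by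
    refine sobolev_ext ?_ ?_
    · exact MemLp.toLp_add (memLp_smooth φ) (memLp_smooth ψ)
    · simp only [map_add, HasWeakGradient.grad_toSobolev, ← MemLp.toLp_add]
      congr 1
      exact gradient_add_smooth φ ψ
  map_smul' c φ := by
    refine sobolev_ext ?_ ?_
    · exact MemLp.toLp_const_smul c (memLp_smooth φ)
    · simp only [map_smul, HasWeakGradient.grad_toSobolev, RingHom.id_apply,
        ← MemLp.toLp_const_smul]
      congr 1
      exact gradient_smul_smooth c φ

variable (P) in
/-- The restriction of smooth functions to the boundary. -/
noncomputable def smoothToBdry : smooth →ₗ[ℝ] P.L2Bdry where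
  toFun φ := (memLp_bdry_smooth φ).toLp
  map_add' φ ψ := MemLp.toLp_add (memLp_bdry_smooth φ) (memLp_bdry_smooth ψ)
  map_smul' c φ := MemLp.toLp_const_smul c (memLp_bdry_smooth φ)

lemma enorm_smoothToSobolev_sq (φ : smooth) : ‖P.smoothToSobolev φ‖ₑ ^ 2 =
    (∫⁻ x in P.K, ‖φ.1 x‖ₑ ^ 2) + ∫⁻ x in P.K, ‖gradient φ.1 x‖ₑ ^ 2 := by
  rw [sobolev_enorm_sq, ← (memLp_smooth φ).enorm_toLp_sq, ← (memLp_gradient_smooth φ).enorm_toLp_sq]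
  rfl

variable (P) in
lemma denseRange_smoothToSobolev : DenseRange P.smoothToSobolev := by
  intro x
  rw [Metric.mem_closure_range_iff]
  intro η hη
  have hδ : ENNReal.ofReal (η / 2) ^ 2 / 2 ≠ 0 :=
    (ENNReal.div_pos (pow_ne_zero _ (by simpa using hη)) (by simp)).ne'
  obtain ⟨φ, hφ, h1, h2⟩ := (hasWeakGradient_val x).exists_smooth_approx hδ
  refine ⟨⟨φ, hφ⟩, ?_⟩
  have h3 : ‖P.smoothToSobolev ⟨φ, hφ⟩ - x‖ₑ ^ 2 ≤ ENNReal.ofReal (η / 2) ^ 2 := by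
    rw [sobolev_enorm_sq, map_sub, map_sub, ← ENNReal.add_halves (ENNReal.ofReal (η / 2) ^ 2)]
    refine add_le_add ?_ ?_
    · refine le_trans (le_of_eq ?_) h1
      exact (memLp_smooth ⟨φ, hφ⟩).enorm_toLp_sub_sq (P.val x)
    · refine le_trans (le_of_eq ?_) h2
      exact (memLp_gradient_smooth ⟨φ, hφ⟩).enorm_toLp_sub_sq (P.grad x)
  have h4 : ‖P.smoothToSobolev ⟨φ, hφ⟩ - x‖ₑ ≤ ENNReal.ofReal (η / 2) :=
    (ENNReal.pow_le_pow_left_iff two_ne_zero).1 h3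
  rw [dist_comm, dist_eq_norm]
  rw [← ofReal_norm, ENNReal.ofReal_le_ofReal_iff (by positivity)] at h4
  linarith

/-! ### The trace operator. -/

variable (P) in
lemma exists_norm_smoothToBdry_le :
    ∃ C : ℝ, ∀ φ, ‖P.smoothToBdry φ‖ ≤ C * ‖P.smoothToSobolev φ‖ := by
  obtain ⟨C, hC, h⟩ := P.exists_trace_inequality
  refine ⟨√C.toReal, fun φ => norm_le_sqrt_mul_of_enorm_sq_le hC ?_⟩
  have hm : Measurable fun x => ‖φ.1 x‖ₑ ^ 2 := ((contDiff_smooth φ).continuous.measurable.enorm.pow_const 2)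
  rw [enorm_smoothToSobolev_sq, ← lintegral_add_left hm]
  refine le_trans (le_of_eq ?_) (h φ.1 ((contDiff_smooth φ).of_le (by simp)))
  exact (memLp_bdry_smooth φ).enorm_toLp_sq

variable (P) in
/-- The trace operator on the Sobolev space. -/
noncomputable def traceCLM : P.sobolev →L[ℝ] P.L2Bdry :=
  P.smoothToBdry.extendOfNorm P.smoothToSobolev

lemma traceCLM_smooth (φ : smooth) : P.traceCLM (P.smoothToSobolev φ) = P.smoothToBdry φ :=
  LinearMap.extendOfNorm_eq P.denseRange_smoothToSobolev P.exists_norm_smoothToBdry_le φ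

/-- On smooth functions `traceCLM` is restriction to the boundary. By continuity, the boundary limit
of any approximating sequence is its value; by density, every element of `sobolev` has such a
sequence. Hence existence and uniqueness of traces. -/
lemma isTrace_iff {v : P.L2} {t : P.L2Bdry} :
    P.IsTrace v t ↔ ∃ x : P.sobolev, P.val x = v ∧ P.traceCLM x = t := by
  have key (x : P.sobolev) (φ : ℕ → smooth) :
      (Tendsto (fun n => eLpNorm (fun y => (φ n).1 y - P.val x y) 2 P.bulkMeasure) atTop (𝓝 0) ∧
      Tendsto (fun n => eLpNorm (fun y => gradient (φ n).1 y - P.grad x y) 2 P.bulkMeasure)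
        atTop (𝓝 0)) ↔ Tendsto (fun n => P.smoothToSobolev (φ n)) atTop (𝓝 x) := by
    rw [tendsto_sobolev_iff]
    refine and_congr ?_ ?_
    · have := Lp.tendsto_Lp_iff_tendsto_eLpNorm'' (fi := atTop) (μ := P.bulkMeasure) (p := 2)
        (fun n => (φ n).1) (fun n => memLp_smooth (φ n)) (P.val x) (Lp.memLp _)
      rw [Lp.toLp_coeFn] at this
      exact this.symm
    · have := Lp.tendsto_Lp_iff_tendsto_eLpNorm'' (fi := atTop) (μ := P.bulkMeasure) (p := 2)
        (fun n => gradient (φ n).1) (fun n => memLp_gradient_smooth (φ n)) (P.grad x) (Lp.memLp _)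
      rw [Lp.toLp_coeFn] at this
      exact this.symm
  have key' (t : P.L2Bdry) (φ : ℕ → smooth) :
      Tendsto (fun n => eLpNorm (fun y => (φ n).1 y - t y) 2 P.bdryMeasure) atTop (𝓝 0) ↔
        Tendsto (fun n => P.smoothToBdry (φ n)) atTop (𝓝 t) := by
    have := Lp.tendsto_Lp_iff_tendsto_eLpNorm'' (fi := atTop) (μ := P.bdryMeasure) (p := 2)
      (fun n => (φ n).1) (fun n => memLp_bdry_smooth (φ n)) t (Lp.memLp _)
    rw [Lp.toLp_coeFn] at this
    exact this.symm
  constructor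
  · rintro ⟨g, hg, φ, hφ, h1, h2, h3⟩
    refine ⟨hg.toSobolev, rfl, ?_⟩
    have h4 := (key hg.toSobolev fun n => ⟨φ n, hφ n⟩).1 ⟨h1, h2⟩
    have h5 := (key' t fun n => ⟨φ n, hφ n⟩).1 h3
    refine tendsto_nhds_unique ((P.traceCLM.continuous.tendsto _).comp h4) (h5.congr fun n => ?_)
    exact (traceCLM_smooth _).symm
  · rintro ⟨x, rfl, rfl⟩
    obtain ⟨u, hu, hux⟩ := mem_closure_iff_seq_limit.1 (P.denseRange_smoothToSobolev x)
    choose φ hφ using hu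
    have h4 : Tendsto (fun n => P.smoothToSobolev (φ n)) atTop (𝓝 x) := by simpa only [hφ] using hux
    refine ⟨P.grad x, hasWeakGradient_val x, fun n => φ n, fun n => (φ n).2,
      ((key x φ).2 h4).1, ((key x φ).2 h4).2, (key' _ φ).2 ?_⟩
    refine ((P.traceCLM.continuous.tendsto x).comp h4).congr fun n => ?_
    exact traceCLM_smooth _

lemma isTrace_val_iff {x : P.sobolev} {t : P.L2Bdry} :
    P.IsTrace (P.val x) t ↔ t = P.traceCLM x := by
  rw [isTrace_iff]
  constructor
  · rintro ⟨y, hy, rfl⟩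
    rw [val_injective hy]
  · rintro rfl
    exact ⟨x, rfl, rfl⟩

lemma trace_val (x : P.sobolev) : P.trace (P.val x) = P.traceCLM x := by
  have h : ∃ t, P.IsTrace (P.val x) t := ⟨_, isTrace_val_iff.2 rfl⟩
  rw [trace, dif_pos h]
  exact isTrace_val_iff.1 h.choose_spec

end CurvedPolygon

/-! ### A moment problem in Hilbert space. -/

/-- Moment problems: if the seminorm `‖G ·‖` together with finitely many linearly independent
functionals controls the norm of a Hilbert space, then the functionals attain all values on the
vectors `x` for which `⟪G x, G ·⟫` is a combination of the functionals. -/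
lemma exists_moments_of_coercive {H E κ : Type*} [NormedAddCommGroup H] [InnerProductSpace ℝ H]
    [CompleteSpace H] [NormedAddCommGroup E] [InnerProductSpace ℝ E] [Fintype κ] (G : H →L[ℝ] E)
    (D : κ → H →L[ℝ] ℝ) (hD : LinearIndependent ℝ D) {c : ℝ} (hc : 0 < c)
    (h : ∀ x, c * ‖x‖ ^ 2 ≤ ‖G x‖ ^ 2 + ∑ i, D i x ^ 2) (d : κ → ℝ) :
    ∃ (x : H) (l : κ → ℝ), (∀ i, D i x = d i) ∧
      ∀ w, inner ℝ (G x) (G w) = ∑ i, l i * D i w := by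
  let B : H →L[ℝ] H →L[ℝ] ℝ :=
    ContinuousLinearMap.bilinearComp
      (isBoundedBilinearMap_inner (𝕜 := ℝ) (E := E)).toContinuousLinearMap G G + ∑ i, (D i).smulRight (D i)
  have hBa (u w : H) : B u w = inner ℝ (G u) (G w) + ∑ i, D i u * D i w := by
    simp [B, _root_.sum_apply]
  have hB : IsCoercive B := by
    refine ⟨c, hc, fun u => ?_⟩
    rw [hBa, real_inner_self_eq_norm_sq, mul_assoc, ← sq]
    simpa only [sq] using h u
  -- Lax–Milgram: `u i` represents `D i` with respect to the coercive form `B`.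
  have hr (i : κ) : ∃ u, ∀ w, B u w = D i w := by
    refine ⟨hB.continuousLinearEquivOfBilin.symm ((InnerProductSpace.toDual ℝ H).symm (D i)),
      fun w => ?_⟩
    rw [← hB.continuousLinearEquivOfBilin_apply, ContinuousLinearEquiv.apply_symm_apply,
      InnerProductSpace.toDual_symm_apply]
  choose u hu using hr
  have hs (a : κ → ℝ) (w : H) : B (∑ i, a i • u i) w = ∑ i, a i * D i w := by
    simp [map_sum, _root_.sum_apply, hu]
  let T : (κ → ℝ) →ₗ[ℝ] (κ → ℝ) :=
    (LinearMap.pi fun j => (D j).toLinearMap) ∘ₗ Fintype.linearCombination ℝ u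
  have hT (a : κ → ℝ) (j : κ) : T a j = D j (∑ i, a i • u i) := by
    simp [T, Fintype.linearCombination_apply]
  -- `T` is a square system, so injectivity suffices. If all `D j x` vanish for `x = ∑ a i • u i`,
  -- then `B x x = ∑ a i * D i x = 0`, so `x = 0` by coercivity; but `B x` is `∑ a i • D i`, and the
  -- functionals are independent.
  have hinj : Function.Injective T := by
    rw [injective_iff_map_eq_zero]
    intro a ha
    set x := ∑ i, a i • u i with hx
    have hDx (j : κ) : D j x = 0 := by rw [hx, ← hT, ha, Pi.zero_apply]
    have h1 : B x x = 0 := by rw [hx, hs]; simp [← hx, hDx]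
    have h2 : ‖G x‖ ^ 2 = 0 := by
      rw [hBa, real_inner_self_eq_norm_sq] at h1
      simpa [hDx] using h1
    have h3 : x = 0 := by
      have h4 := h x
      rw [h2] at h4
      simp only [hDx, ne_eq, OfNat.ofNat_ne_zero, not_false_eq_true, zero_pow,
        Finset.sum_const_zero, add_zero] at h4
      have h5 : ‖x‖ ^ 2 ≤ 0 := nonpos_of_mul_nonpos_right h4 hc
      exact norm_eq_zero.1 (pow_eq_zero_iff two_ne_zero |>.1 (le_antisymm h5 (by positivity)))
    have h6 : ∑ i, a i • D i = 0 := by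
      ext w
      have := hs a w
      rw [← hx, h3] at this
      simpa [_root_.sum_apply] using this.symm
    exact funext (Fintype.linearIndependent_iff.1 hD a h6)
  obtain ⟨a, ha⟩ := (LinearMap.injective_iff_surjective.1 hinj) d
  -- The form `B` exceeds `inner (G x) (G w)` by `∑ D i x * D i w`, where `D i x = d i`; hence the
  -- multipliers `a i - d i`.
  refine ⟨∑ i, a i • u i, fun i => a i - d i, fun i => by rw [← hT, ha], fun w => ?_⟩
  have h1 := hs a w
  rw [hBa] at h1
  have h2 (i : κ) : D i (∑ j, a j • u j) = d i := by rw [← hT, ha]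
  simp only [h2] at h1
  simp only [sub_mul, Finset.sum_sub_distrib]
  linarith

/-! ### The Poincaré inequality and coercivity. -/

namespace CurvedPolygon

variable {ι : Type*} [Fintype ι] {P : CurvedPolygon ι}

/-- The constant function `1`. -/
def smoothOne : smooth := ⟨fun _ => 1, (contDiff_const : ContDiff ℝ ∞ fun _ : Plane => (1 : ℝ))⟩

lemma gradient_sub_smul_smoothOne (φ : smooth) (m : ℝ) :
    gradient (φ - m • smoothOne).1 = gradient φ.1 := by
  ext1 x
  have h1 : fderiv ℝ (φ - m • smoothOne).1 x = fderiv ℝ φ.1 x := by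
    have : (φ - m • smoothOne).1 = fun y => φ.1 y - m := by
      ext y; simp [smoothOne]
    rw [this, fderiv_sub_const]
  rw [gradient, h1, gradient]

/-- The average over a ball of smooth functions. -/
lemma enorm_sub_average_sq_le {φ : Plane → ℝ} (hφ : Continuous φ) {c : Plane} {r : ℝ} (hr : 0 < r)
    (x : Plane) : ‖φ x - (volume.real (Metric.ball c r))⁻¹ * ∫ y in Metric.ball c r, φ y‖ₑ ^ 2 ≤
      (volume (Metric.ball c r))⁻¹ * ∫⁻ y in Metric.ball c r, ‖φ x - φ y‖ₑ ^ 2 := by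
  set B := Metric.ball c r
  have hB0 : volume B ≠ 0 := (Metric.measure_ball_pos volume c hr).ne'
  have hBt : volume B ≠ ⊤ := measure_ball_lt_top.ne
  have hBr : volume.real B ≠ 0 := (ENNReal.toReal_ne_zero).2 ⟨hB0, hBt⟩
  have hi : IntegrableOn φ B :=
    (hφ.continuousOn.integrableOn_compact (isCompact_closedBall c r)).mono_set
      Metric.ball_subset_closedBall
  have h1 : φ x - (volume.real B)⁻¹ * ∫ y in B, φ y =
      (volume.real B)⁻¹ * ∫ y in B, (φ x - φ y) := by
    rw [integral_sub (integrable_const_iff.2 (Or.inr ⟨by simpa using hBt.lt_top⟩)) hi, setIntegral_const, smul_eq_mul]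
    field_simp
  rw [h1, enorm_mul, mul_pow]
  have h2 : ‖(volume.real B)⁻¹‖ₑ = (volume B)⁻¹ := by
    rw [enorm_inv hBr, Real.enorm_of_nonneg measureReal_nonneg, Measure.real,
      ENNReal.ofReal_toReal hBt]
  have hm : Measurable fun y => ‖φ x - φ y‖ₑ := (hφ.measurable.const_sub _).enorm
  calc _ ≤ (volume B)⁻¹ ^ 2 * (volume B * ∫⁻ y in B, ‖φ x - φ y‖ₑ ^ 2) := by
        rw [h2]
        gcongr
        refine (pow_le_pow_left₀ zero_le (enorm_integral_le_lintegral_enorm _) 2).trans ?_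
        refine (sq_lintegral_le _ hm.aemeasurable).trans (le_of_eq ?_)
        rw [Measure.restrict_apply_univ]
    _ = (volume B)⁻¹ * ((volume B)⁻¹ * volume B) * ∫⁻ y in B, ‖φ x - φ y‖ₑ ^ 2 := by ring
    _ = _ := by rw [ENNReal.inv_mul_cancel hB0 hBt, mul_one]

variable (P) in
/-- The Poincaré inequality. -/
lemma exists_poincare : ∃ (C : ℝ) (m : P.sobolev →L[ℝ] ℝ), ∀ x,
    ‖x - m x • P.smoothToSobolev smoothOne‖ ≤ C * ‖P.grad x‖ := by
  obtain ⟨c, r, h⟩ := P.exists_starBall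
  obtain ⟨D, hDt, hD⟩ := P.exists_diam_bound
  set B := Metric.ball c r with hB
  have hB0 : volume B ≠ 0 := (Metric.measure_ball_pos volume c h.pos).ne'
  have hBt : volume B ≠ ⊤ := measure_ball_lt_top.ne
  have hBm : MeasurableSet B := Metric.isOpen_ball.measurableSet
  have hBK : P.bulkMeasure B ≠ ⊤ := measure_ne_top _ _
  let m : P.sobolev →L[ℝ] ℝ :=
    ((volume.real B)⁻¹ • innerSL ℝ (indicatorConstLp 2 hBm hBK (1 : ℝ))).comp P.val
  -- The first summand bounds the function minus its mean over the ball; the `+ 1` accounts for the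
  -- gradient part of the Sobolev norm, which subtracting a constant leaves unchanged.
  set C : ℝ≥0∞ := (volume B)⁻¹ * (D ^ 2 * (4 * (volume P.K + volume B))) + 1 with hC
  have hCt : C ≠ ⊤ := by
    refine ENNReal.add_ne_top.2 ⟨ENNReal.mul_ne_top (ENNReal.inv_ne_top.2 hB0)
      (ENNReal.mul_ne_top (ENNReal.pow_ne_top hDt) (ENNReal.mul_ne_top (by simp)
        (ENNReal.add_ne_top.2 ⟨P.bounded.measure_lt_top.ne, hBt⟩))), by simp⟩
  refine ⟨√C.toReal, m, fun x => ?_⟩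
  -- Both sides are continuous in `x`, so smooth functions suffice.
  refine P.denseRange_smoothToSobolev.induction_on (p := fun x =>
    ‖x - m x • P.smoothToSobolev smoothOne‖ ≤ √C.toReal * ‖P.grad x‖) x ?_ ?_
  · exact isClosed_le (by fun_prop) (by fun_prop)
  · intro φ
    refine norm_le_sqrt_mul_of_enorm_sq_le hCt ?_
    have hm : m (P.smoothToSobolev φ) = (volume.real B)⁻¹ * ∫ y in B, φ.1 y := by
      simp only [m, ContinuousLinearMap.comp_apply, _root_.smul_apply, innerSL_apply_apply,
        smul_eq_mul, L2.inner_indicatorConstLp_one]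
      congr 1
      have h1 : ∫ y in B, P.val (P.smoothToSobolev φ) y ∂P.bulkMeasure =
          ∫ y in B, φ.1 y ∂P.bulkMeasure :=
        setIntegral_congr_ae hBm ((memLp_smooth φ).coeFn_toLp.mono fun y hy _ => hy)
      rw [h1, bulkMeasure, Measure.restrict_restrict hBm, inter_eq_left.2 h.ball_subset]
    rw [hm, ← map_smul, ← map_sub, enorm_smoothToSobolev_sq, gradient_sub_smul_smoothOne]
    have hg : ‖P.grad (P.smoothToSobolev φ)‖ₑ ^ 2 = ∫⁻ x in P.K, ‖gradient φ.1 x‖ₑ ^ 2 :=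
      (memLp_gradient_smooth φ).enorm_toLp_sq
    rw [hg, hC, add_mul, one_mul]
    gcongr
    calc _ ≤ ∫⁻ x in P.K, (volume B)⁻¹ * ∫⁻ y in B, ‖φ.1 x - φ.1 y‖ₑ ^ 2 := by
          refine lintegral_mono fun x => ?_
          have := enorm_sub_average_sq_le (contDiff_smooth φ).continuous (c := c) h.pos x
          have h3 : (φ - ((volume.real B)⁻¹ * ∫ y in B, φ.1 y) • smoothOne).1 x =
              φ.1 x - (volume.real B)⁻¹ * ∫ y in B, φ.1 y := by
            change φ.1 x - _ * 1 = _
            rw [mul_one]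
          rw [h3]
          exact this
      _ ≤ (volume B)⁻¹ * (D ^ 2 * (4 * (volume P.K + volume B) *
          ∫⁻ x in P.K, ‖gradient φ.1 x‖ₑ ^ 2)) := by
          rw [lintegral_const_mul' _ _ (ENNReal.inv_ne_top.2 hB0)]
          gcongr
          exact h.lintegral_lintegral_enorm_sub_sq_le P.isOpen hDt
            (fun x hx y hy => hD x (subset_closure hx) y (subset_closure hy))
            ((contDiff_smooth φ).of_le (by simp))
      _ = _ := by ring

/-- The gradient seminorm together with a functional that does not vanish on the constants
controls the Sobolev norm. -/
lemma exists_coercive {l : P.sobolev →L[ℝ] ℝ} (hl : l (P.smoothToSobolev smoothOne) ≠ 0) :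
    ∃ c : ℝ, 0 < c ∧ ∀ x, c * ‖x‖ ^ 2 ≤ ‖P.grad x‖ ^ 2 + l x ^ 2 := by
  obtain ⟨C, m, h⟩ := P.exists_poincare
  set o := P.smoothToSobolev smoothOne
  have hlo : 0 < |l o| := abs_pos.2 hl
  set A := |C| + ‖o‖ / |l o| * (1 + ‖l‖ * |C|) + 1 with hA
  have hA0 : 0 < A := by positivity
  -- Split `x` into its Poincaré remainder and `m x • o`; applying `l` to this splitting bounds `m
  -- x`. This gives `‖x‖ ≤ A (‖∇x‖ + |l x|)`, and squaring the sum costs the factor 2.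
  refine ⟨1 / (2 * A ^ 2), by positivity, fun x => ?_⟩
  have h1 : ‖x - m x • o‖ ≤ |C| * ‖P.grad x‖ :=
    (h x).trans (mul_le_mul_of_nonneg_right (le_abs_self C) (norm_nonneg _))
  have h2 : |m x| ≤ (|l x| + ‖l‖ * (|C| * ‖P.grad x‖)) / |l o| := by
    rw [le_div_iff₀ hlo, ← abs_mul]
    have h3 : m x * l o = l x - l (x - m x • o) := by simp
    rw [h3]
    refine (abs_sub _ _).trans ?_
    gcongr
    exact (l.le_opNorm _).trans (by gcongr)
  have h4 : ‖x‖ ≤ A * (‖P.grad x‖ + |l x|) := by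
    calc ‖x‖ = ‖(x - m x • o) + m x • o‖ := by rw [sub_add_cancel]
      _ ≤ |C| * ‖P.grad x‖ + |m x| * ‖o‖ := by
          refine (norm_add_le _ _).trans ?_
          rw [norm_smul, Real.norm_eq_abs]
          gcongr
      _ ≤ |C| * ‖P.grad x‖ + (|l x| + ‖l‖ * (|C| * ‖P.grad x‖)) / |l o| * ‖o‖ := by gcongr
      _ = (|C| + ‖o‖ / |l o| * (‖l‖ * |C|)) * ‖P.grad x‖ + ‖o‖ / |l o| * |l x| := by ring
      _ ≤ A * ‖P.grad x‖ + A * |l x| := by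
          have e1 : 0 ≤ ‖o‖ / |l o| := by positivity
          have e2 : 0 ≤ ‖o‖ / |l o| * (‖l‖ * |C|) := by positivity
          have e3 := abs_nonneg C
          have e4 : A = |C| + ‖o‖ / |l o| + ‖o‖ / |l o| * (‖l‖ * |C|) + 1 := by rw [hA]; ring
          gcongr <;> linarith
      _ = _ := by ring
  have h5 : ‖x‖ ^ 2 ≤ 2 * A ^ 2 * (‖P.grad x‖ ^ 2 + l x ^ 2) := by
    calc ‖x‖ ^ 2 ≤ (A * (‖P.grad x‖ + |l x|)) ^ 2 := by gcongr
      _ = A ^ 2 * (‖P.grad x‖ + |l x|) ^ 2 := by ring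
      _ ≤ A ^ 2 * (2 * (‖P.grad x‖ ^ 2 + |l x| ^ 2)) := by gcongr; exact add_sq_le
      _ = _ := by rw [sq_abs]; ring
  rw [one_div, inv_mul_le_iff₀ (by positivity)]
  exact h5

end CurvedPolygon

namespace CurvedPolygon

/-! ### Polynomials under affine substitutions -/

/-- The substitution `y ↦ s y + b` in polynomials in two variables. -/
noncomputable def affineSubst (s : ℝ) (b : Fin 2 → ℝ) :
    MvPolynomial (Fin 2) ℝ →ₐ[ℝ] MvPolynomial (Fin 2) ℝ :=
  MvPolynomial.aeval fun i => MvPolynomial.C s * MvPolynomial.X i + MvPolynomial.C (b i)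

lemma eval_affineSubst (s : ℝ) (b y : Fin 2 → ℝ) (p : MvPolynomial (Fin 2) ℝ) :
    MvPolynomial.eval y (affineSubst s b p) = MvPolynomial.eval (fun i => s * y i + b i) p := by
  rw [← MvPolynomial.aeval_eq_eval, ← MvPolynomial.aeval_eq_eval, affineSubst,
    MvPolynomial.comp_aeval_apply]
  congr 2
  ext i
  simp

lemma mem_polyLE_of_totalDegree_le {n : ℤ} {p : MvPolynomial (Fin 2) ℝ}
    (h : (p.totalDegree : ℤ) ≤ n) : p ∈ polyLE n := by
  rw [polyLE, MvPolynomial.mem_restrictSupport_iff]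
  intro α hα
  exact (Int.ofNat_le.2 (MvPolynomial.le_totalDegree hα)).trans h

lemma affineSubst_mem_polyLE (s : ℝ) (b : Fin 2 → ℝ) {n : ℤ} {p : MvPolynomial (Fin 2) ℝ}
    (hp : p ∈ polyLE n) : affineSubst s b p ∈ polyLE n := by
  rw [MvPolynomial.as_sum p, map_sum]
  refine Submodule.sum_mem _ fun α hα => mem_polyLE_of_totalDegree_le ?_
  have hαn : (α.degree : ℤ) ≤ n := (MvPolynomial.mem_restrictSupport_iff ℝ).1 hp hα
  refine le_trans (Int.ofNat_le.2 ?_) hαn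
  rw [affineSubst, MvPolynomial.aeval_monomial, Finsupp.degree_apply]
  refine (MvPolynomial.totalDegree_mul _ _).trans ?_
  have h0 : (algebraMap ℝ (MvPolynomial (Fin 2) ℝ) (MvPolynomial.coeff α p)).totalDegree = 0 :=
    MvPolynomial.totalDegree_C _
  rw [h0, zero_add, Finsupp.prod]
  refine (MvPolynomial.totalDegree_finsetProd _ _).trans (Finset.sum_le_sum fun i _ => ?_)
  refine (MvPolynomial.totalDegree_pow _ _).trans ?_
  refine (Nat.mul_le_mul_left _ ?_).trans (mul_one (α i)).le
  refine (MvPolynomial.totalDegree_add _ _).trans (max_le ?_ ?_)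
  · refine (MvPolynomial.totalDegree_mul _ _).trans ?_
    rw [MvPolynomial.totalDegree_C, MvPolynomial.totalDegree_X, zero_add]
  · rw [MvPolynomial.totalDegree_C]; exact zero_le_one

/-- The index set of the bulk moments. -/
abbrev BulkIndex (n : ℤ) : Type := {α : Fin 2 →₀ ℕ // (α.degree : ℤ) ≤ n}

noncomputable instance (n : ℤ) : Fintype (BulkIndex n) := by
  refine Set.Finite.fintype (s := {α : Fin 2 →₀ ℕ | (α.degree : ℤ) ≤ n}) ?_
  -- For negative `n` the index set is empty, so the truncation by `toNat` is harmless.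
  refine (Finsupp.finite_of_degree_le n.toNat).subset fun α hα => ?_
  have : (α.degree : ℤ) ≤ n := hα
  simp only [mem_ofPred_eq]
  omega

lemma eval_eq_sum_bulkIndex {n : ℤ} {p : MvPolynomial (Fin 2) ℝ} (hp : p ∈ polyLE n)
    (y : Fin 2 → ℝ) :
    MvPolynomial.eval y p = ∑ α : BulkIndex n, p.coeff α.1 * ∏ i, y i ^ α.1 i := by
  rw [MvPolynomial.eval_eq']
  have hs : p.support ⊆ Finset.univ.map (Function.Embedding.subtype _ : BulkIndex n ↪ _) := by
    intro α hα
    rw [Finset.mem_map]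
    exact ⟨⟨α, (MvPolynomial.mem_restrictSupport_iff ℝ).1 hp hα⟩, Finset.mem_univ _, rfl⟩
  rw [Finset.sum_subset hs fun α _ hα => by
    rw [MvPolynomial.notMem_support_iff.1 hα, zero_mul], Finset.sum_map]
  rfl

variable {ι : Type*} [Fintype ι] {P : CurvedPolygon ι}

variable (P) in
lemma diam_pos : 0 < Metric.diam P.K := by
  obtain ⟨c, r, h⟩ := P.exists_starBall
  have h1 := Metric.diam_mono h.ball_subset P.bounded
  refine lt_of_lt_of_le ?_ h1
  have h2 : c + (r / 2) • EuclideanSpace.single 0 (1 : ℝ) ∈ Metric.ball c r := by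
    rw [Metric.mem_ball, dist_self_add_left, norm_smul, Real.norm_of_nonneg (half_pos h.pos).le]
    simpa using h.pos
  refine lt_of_lt_of_le ?_ (Metric.dist_le_diam_of_mem Metric.isBounded_ball h.center_mem_ball h2)
  rw [dist_self_add_right, norm_smul, Real.norm_of_nonneg (half_pos h.pos).le]
  simpa using h.pos

variable (P) in
lemma volume_real_pos : 0 < volume.real P.K :=
  ENNReal.toReal_pos (P.isOpen.measure_pos _ P.nonempty).ne' P.bounded.measure_lt_top.ne

/-! ### Bulk moments -/

lemma continuous_bulkMonomial (α : Fin 2 →₀ ℕ) : Continuous (P.bulkMonomial α) := by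
  unfold bulkMonomial
  fun_prop

variable (P) in
/-- The scaled monomials as elements of `L²(K)`. -/
noncomputable def bulkMonomialL2 (α : Fin 2 →₀ ℕ) : P.L2 :=
  (memLp_bulk (continuous_bulkMonomial (P := P) α)).toLp

lemma coeFn_bulkMonomialL2 (α : Fin 2 →₀ ℕ) :
    P.bulkMonomialL2 α =ᵐ[P.bulkMeasure] P.bulkMonomial α := MemLp.coeFn_toLp _

lemma bulkDof_eq_inner (α : Fin 2 →₀ ℕ) (v : P.L2) :
    P.bulkDof α v = (volume.real P.K)⁻¹ * inner ℝ (P.bulkMonomialL2 α) v := by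
  rw [bulkDof, L2.inner_def]
  congr 1
  refine integral_congr_ae ?_
  filter_upwards [coeFn_bulkMonomialL2 α] with x hx
  rw [hx]
  simp

lemma coeFn_sum_bulk {n : ℤ} (a : BulkIndex n → ℝ) :
    (∑ α, a α • P.bulkMonomialL2 α.1 : P.L2) =ᵐ[P.bulkMeasure]
      fun x => ∑ α, a α * P.bulkMonomial α.1 x := by
  refine (Lp.coeFn_finsetSum _ _).trans ?_
  have h : ∀ α : BulkIndex n, ∀ᵐ x ∂P.bulkMeasure,
      (a α • P.bulkMonomialL2 α.1 : P.L2) x = a α * P.bulkMonomial α.1 x := by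
    intro α
    filter_upwards [Lp.coeFn_smul (a α) (P.bulkMonomialL2 α.1), coeFn_bulkMonomialL2 (P := P) α.1]
      with x h1 h2
    rw [h1, Pi.smul_apply, h2, smul_eq_mul]
  filter_upwards [ae_all_iff.2 h] with x hx
  rw [Finset.sum_apply]
  exact Finset.sum_congr rfl fun α _ => hx α

lemma bulkMonomial_eq (α : Fin 2 →₀ ℕ) (x : Plane) : P.bulkMonomial α x =
    ∏ i, ((Metric.diam P.K)⁻¹ * x i + -(P.centroid i / Metric.diam P.K)) ^ α i := by
  unfold bulkMonomial
  refine Finset.prod_congr rfl fun i _ => ?_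
  congr 1
  ring

/-- Translating by the centroid and scaling by the diameter is an invertible affine substitution
that does not raise the degree, so scaled and plain monomials span the same space. -/
lemma memBulkPoly_iff {n : ℤ} {f : P.L2} :
    P.MemBulkPoly n f ↔ ∃ a : BulkIndex n → ℝ, f = ∑ α, a α • P.bulkMonomialL2 α.1 := by
  have hd := P.diam_pos.ne'
  constructor
  · rintro ⟨p, hp, hf⟩
    have hp' := affineSubst_mem_polyLE (Metric.diam P.K) (fun i => P.centroid i) hp
    refine ⟨fun α => (affineSubst (Metric.diam P.K) (fun i => P.centroid i) p).coeff α.1,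
      Lp.ext ?_⟩
    filter_upwards [hf, coeFn_sum_bulk (P := P) fun α : BulkIndex n =>
      (affineSubst (Metric.diam P.K) (fun i => P.centroid i) p).coeff α.1] with x h1 h2
    rw [h1, h2]
    unfold bulkMonomial
    rw [← eval_eq_sum_bulkIndex hp' fun i => (x i - P.centroid i) / Metric.diam P.K,
      eval_affineSubst]
    congr 2
    ext i
    field_simp
    ring
  · rintro ⟨a, rfl⟩
    set s := (Metric.diam P.K)⁻¹
    set b : Fin 2 → ℝ := fun i => -(P.centroid i / Metric.diam P.K) with hb
    refine ⟨∑ α, a α • affineSubst s b (MvPolynomial.monomial α.1 1),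
      Submodule.sum_mem _ fun α _ => Submodule.smul_mem _ _ (affineSubst_mem_polyLE s b ?_), ?_⟩
    · rw [polyLE, MvPolynomial.mem_restrictSupport_iff]
      refine (Finset.coe_subset.2 MvPolynomial.support_monomial_subset).trans ?_
      simp
    · filter_upwards [coeFn_sum_bulk (P := P) a] with x hx
      rw [hx, map_sum]
      refine Finset.sum_congr rfl fun α _ => ?_
      rw [MvPolynomial.smul_eval, eval_affineSubst, MvPolynomial.eval_monomial, one_mul,
        bulkMonomial_eq, Finsupp.prod_fintype _ _ fun i => pow_zero _]

/-- A vanishing combination is a polynomial that is zero almost everywhere on the open set `K`,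
hence everywhere there by continuity, and a polynomial vanishing on a product of infinite sets is
zero. -/
lemma linearIndependent_bulkMonomialL2 (n : ℤ) :
    LinearIndependent ℝ fun α : BulkIndex n => P.bulkMonomialL2 α.1 := by
  have hd := P.diam_pos
  rw [Fintype.linearIndependent_iff]
  intro a ha α
  have h0 : (fun x => ∑ α, a α * P.bulkMonomial α.1 x) =ᵐ[P.bulkMeasure] fun _ => (0 : ℝ) := by
    refine (coeFn_sum_bulk a).symm.trans ?_
    rw [ha]
    exact Lp.coeFn_zero ℝ 2 P.bulkMeasure
  have hc : Continuous fun x => ∑ α, a α * P.bulkMonomial α.1 x :=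
    continuous_finsetSum _ fun α _ => continuous_const.mul (continuous_bulkMonomial α.1)
  have h1 : ∀ x ∈ P.K, ∑ α, a α * P.bulkMonomial α.1 x = 0 :=
    Measure.eqOn_open_of_ae_eq h0 P.isOpen hc.continuousOn continuousOn_const
  let q : MvPolynomial (Fin 2) ℝ := ∑ α : BulkIndex n, MvPolynomial.monomial α.1 (a α)
  have hq (x : Plane) : MvPolynomial.eval (fun i => (x i - P.centroid i) / Metric.diam P.K) q =
      ∑ α, a α * P.bulkMonomial α.1 x := by
    simp only [q, map_sum, MvPolynomial.eval_monomial]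
    refine Finset.sum_congr rfl fun α _ => ?_
    rw [bulkMonomial, Finsupp.prod_fintype _ _ fun i => pow_zero _]
  obtain ⟨c, r, h⟩ := P.exists_starBall
  have hq0 : q = 0 := by
    -- The square of half-side `r / 2` around `c` lies in the ball, as `2 (r / 2)² < r²`.
    refine MvPolynomial.funext_set (fun i => (fun t => (t - P.centroid i) / Metric.diam P.K) ''
      Ioo (c i - r / 2) (c i + r / 2)) (fun i => ?_) fun y hy => ?_
    · refine (Ioo_infinite (by linarith [h.pos])).image fun t _ t' _ htt => ?_
      have := (div_left_inj' hd.ne').1 htt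
      linarith
    · choose t ht hty using fun i => hy i (mem_univ i)
      have h2 : WithLp.toLp 2 t ∈ P.K := by
        refine h.ball_subset ?_
        rw [Metric.mem_ball, EuclideanSpace.dist_eq, Real.sqrt_lt' h.pos, Fin.sum_univ_two]
        have h3 (i : Fin 2) : dist (t i) (c i) ^ 2 < (r / 2) ^ 2 := by
          rw [Real.dist_eq]
          refine pow_lt_pow_left₀ (abs_lt.2 ⟨?_, ?_⟩) (abs_nonneg _) two_ne_zero
          · linarith [(ht i).1]
          · linarith [(ht i).2]
        have h4 := h3 0
        have h5 := h3 1
        have := h.pos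
        simp only
        nlinarith
      have h6 := hq (WithLp.toLp 2 t)
      rw [h1 _ h2] at h6
      rw [map_zero, ← h6]
      congr 1
      exact congrArg _ (funext fun i => (hty i).symm)
  have h7 : q.coeff α.1 = a α := by
    simp only [q, MvPolynomial.coeff_sum, MvPolynomial.coeff_monomial]
    rw [Finset.sum_eq_single α]
    · simp
    · intro β _ hβ
      rw [if_neg fun hh => hβ (Subtype.ext hh)]
    · simp
  rw [← h7, hq0, MvPolynomial.coeff_zero]

end CurvedPolygon

namespace CurvedPolygon

variable {ι : Type*} [Fintype ι] {P : CurvedPolygon ι}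

/-! ### Edge moments -/

lemma γInv_γ (e : ι) {t : ℝ} (ht : t ∈ Icc (P.a e) (P.b e)) : P.γInv e (P.γ e t) = t :=
  (P.injOn e).leftInvOn_invFunOn ht

variable (P) in
/-- The edge without its endpoints. -/
def arc (e : ι) : Set Plane := P.γ e '' Ioo (P.a e) (P.b e)

lemma measurableSet_arc (e : ι) : MeasurableSet (P.arc e) :=
  measurableSet_Ioo.image_of_continuousOn_injOn
    ((P.contDiffOn e).continuousOn.mono Ioo_subset_Icc_self) ((P.injOn e).mono Ioo_subset_Icc_self)

lemma γInv_mem_of_mem_arc {e : ι} {x : Plane} (hx : x ∈ P.arc e) :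
    P.γInv e x ∈ Ioo (P.a e) (P.b e) := by
  obtain ⟨t, ht, rfl⟩ := hx
  rwa [γInv_γ e (Ioo_subset_Icc_self ht)]

/-- A continuous injection of a compact interval maps closed subsets to compact, hence closed, sets.
-/
lemma continuousOn_γInv (e : ι) : ContinuousOn (P.γInv e) (P.γ e '' Icc (P.a e) (P.b e)) := by
  rw [continuousOn_iff_isClosed]
  intro C hC
  refine ⟨P.γ e '' (Icc (P.a e) (P.b e) ∩ C), ?_, ?_⟩
  · refine IsCompact.isClosed ((isCompact_Icc.inter_right hC).image_of_continuousOn ?_)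
    exact (P.contDiffOn e).continuousOn.mono inter_subset_left
  · ext x
    constructor
    · rintro ⟨hx, t, ht, rfl⟩
      refine ⟨⟨t, ⟨ht, ?_⟩, rfl⟩, t, ht, rfl⟩
      rwa [mem_preimage, γInv_γ e ht] at hx
    · rintro ⟨⟨t, ⟨ht, htC⟩, rfl⟩, hx⟩
      refine ⟨?_, hx⟩
      rwa [mem_preimage, γInv_γ e ht]

lemma ae_edgeMeasure_mem_arc (e : ι) : ∀ᵐ x ∂P.edgeMeasure e, x ∈ P.arc e := by
  refine (P.ae_edgeMeasure_iff e (p := (· ∈ P.arc e)) (measurableSet_arc e)).2 ?_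
  filter_upwards [ae_restrict_mem measurableSet_Ioo] with t ht using ⟨t, ht, rfl⟩

lemma notMem_arc {e e' : ι} (he : e ≠ e') {x : Plane} (hx : x ∈ P.arc e') : x ∉ P.arc e :=
  fun h => (P.disjoint e e' he).ne_of_mem h (image_mono Ioo_subset_Icc_self hx) rfl

/-- Cutting off to the open arc makes the monomials of different edges have disjoint supports, so
that independent conditions on the edges become one statement in `L²(∂K)`. -/
lemma memLp_edgeMonomial (e : ι) (i : ℕ) :
    MemLp ((P.arc e).indicator (P.edgeMonomial e i)) 2 P.bdryMeasure := by
  rw [memLp_indicator_iff_restrict (measurableSet_arc e)]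
  have hc : ContinuousOn (P.edgeMonomial e i) (P.arc e) := by
    unfold edgeMonomial
    exact ((((continuousOn_γInv e).mono (image_mono Ioo_subset_Icc_self)).sub
      continuousOn_const).div_const _).pow i
  refine MemLp.of_bound (hc.aestronglyMeasurable (measurableSet_arc e)) 1 ?_
  filter_upwards [ae_restrict_mem (measurableSet_arc e)] with x hx
  have hx' := γInv_mem_of_mem_arc hx
  have hab := P.a_lt_b e
  rw [edgeMonomial, norm_pow]
  refine pow_le_one₀ (norm_nonneg _) ?_
  rw [Real.norm_eq_abs, abs_div, abs_of_pos (sub_pos.2 hab), div_le_one (sub_pos.2 hab), abs_le]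
  constructor <;> linarith [hx'.1, hx'.2]

variable (P) in
/-- The mapped scaled monomials, extended by zero to the other edges, as elements of `L²(∂K)`. -/
noncomputable def edgeMonomialL2 (e : ι) (i : ℕ) : P.L2Bdry := (memLp_edgeMonomial (P := P) e i).toLp

lemma ae_edgeMeasure_of_ae_bdryMeasure {p : Plane → Prop} (h : ∀ᵐ x ∂P.bdryMeasure, p x) (e : ι) :
    ∀ᵐ x ∂P.edgeMeasure e, p x := ae_bdryMeasure_iff.1 h e

lemma edgeMonomialL2_ae_self (e : ι) (i : ℕ) :
    P.edgeMonomialL2 e i =ᵐ[P.edgeMeasure e] P.edgeMonomial e i := by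
  filter_upwards [ae_edgeMeasure_of_ae_bdryMeasure (memLp_edgeMonomial (P := P) e i).coeFn_toLp e,
    ae_edgeMeasure_mem_arc e] with x h1 h2
  rw [edgeMonomialL2, h1, indicator_of_mem h2]

lemma edgeMonomialL2_ae_other {e e' : ι} (he : e ≠ e') (i : ℕ) :
    P.edgeMonomialL2 e i =ᵐ[P.edgeMeasure e'] 0 := by
  filter_upwards [ae_edgeMeasure_of_ae_bdryMeasure (memLp_edgeMonomial (P := P) e i).coeFn_toLp e',
    ae_edgeMeasure_mem_arc e'] with x h1 h2
  rw [edgeMonomialL2, h1, indicator_of_notMem (notMem_arc he h2), Pi.zero_apply]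

lemma integral_bdryMeasure {f : Plane → ℝ} (hf : Integrable f P.bdryMeasure) :
    ∫ x, f x ∂P.bdryMeasure = ∑ e, ∫ x, f x ∂P.edgeMeasure e := by
  rw [bdryMeasure, integral_finsetSum_measure fun e _ => hf.mono_measure (P.edgeMeasure_le e)]

lemma edgeDof_eq_inner (e : ι) (i : ℕ) (v : P.L2) :
    P.edgeDof e i v = (P.edgeLength e)⁻¹ * inner ℝ (P.edgeMonomialL2 e i) (P.trace v) := by
  rw [edgeDof, L2.inner_def]
  congr 1
  have hint : Integrable (fun x => inner ℝ (P.edgeMonomialL2 e i x) (P.trace v x)) P.bdryMeasure :=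
    L2.integrable_inner _ _
  rw [integral_bdryMeasure hint, Finset.sum_eq_single e]
  · refine integral_congr_ae ?_
    filter_upwards [edgeMonomialL2_ae_self (P := P) e i] with x hx
    rw [hx]
    simp
  · intro e' _ he'
    refine integral_eq_zero_of_ae ?_
    filter_upwards [edgeMonomialL2_ae_other (P := P) he'.symm i] with x hx
    rw [hx]
    simp
  · simp

lemma sum_edgeMonomialL2_ae {k : ℕ} (a : ι × Fin k → ℝ) (e : ι) :
    (∑ s, a s • P.edgeMonomialL2 s.1 s.2 : P.L2Bdry) =ᵐ[P.edgeMeasure e]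
      fun x => ∑ i : Fin k, a (e, i) * P.edgeMonomial e i x := by
  have h0 := ae_edgeMeasure_of_ae_bdryMeasure (Lp.coeFn_finsetSum Finset.univ
    fun s : ι × Fin k => a s • P.edgeMonomialL2 s.1 s.2) e
  have h1 : ∀ s : ι × Fin k, ∀ᵐ x ∂P.edgeMeasure e,
      (a s • P.edgeMonomialL2 s.1 s.2 : P.L2Bdry) x = a s * P.edgeMonomialL2 s.1 s.2 x := fun s => by
    filter_upwards [ae_edgeMeasure_of_ae_bdryMeasure
      (Lp.coeFn_smul (a s) (P.edgeMonomialL2 s.1 s.2)) e] with x hx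
    rw [hx, Pi.smul_apply, smul_eq_mul]
  have h2 : ∀ i : Fin k, ∀ᵐ x ∂P.edgeMeasure e,
      P.edgeMonomialL2 e i x = P.edgeMonomial e i x := fun i => edgeMonomialL2_ae_self e i
  have h3 : ∀ s : ι × Fin k, ∀ᵐ x ∂P.edgeMeasure e,
      s.1 ≠ e → P.edgeMonomialL2 s.1 s.2 x = 0 := fun s => by
    by_cases hs : s.1 = e
    · simp [hs]
    · filter_upwards [edgeMonomialL2_ae_other (P := P) hs s.2] with x hx _ using hx
  filter_upwards [h0, ae_all_iff.2 h1, ae_all_iff.2 h2, ae_all_iff.2 h3] with x g0 g1 g2 g3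
  rw [g0, Finset.sum_apply, Fintype.sum_prod_type, Finset.sum_eq_single e]
  · exact Finset.sum_congr rfl fun i _ => by rw [g1, g2]
  · intro e' _ he'
    exact Finset.sum_eq_zero fun i _ => by rw [g1, g3 _ he', mul_zero]
  · simp

/-- The zero polynomial has `natDegree` 0, which is why `1 ≤ k` is assumed. -/
lemma mem_degreeLT_iff_natDegree_lt {k : ℕ} (hk : 1 ≤ k) {q : Polynomial ℝ} :
    q ∈ Polynomial.degreeLT ℝ k ↔ q.natDegree < k := by
  rw [Polynomial.mem_degreeLT]
  by_cases hq : q = 0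
  · subst hq
    simp only [Polynomial.degree_zero, Polynomial.natDegree_zero]
    exact ⟨fun _ => hk, fun _ => WithBot.bot_lt_coe k⟩
  · exact (Polynomial.natDegree_lt_iff_degree_lt hq).symm

lemma natDegree_comp_linear_le (q : Polynomial ℝ) (s b : ℝ) :
    (q.comp (Polynomial.C s * Polynomial.X + Polynomial.C b)).natDegree ≤ q.natDegree := by
  refine Polynomial.natDegree_comp_le.trans ?_
  exact (Nat.mul_le_mul_left _ (Polynomial.natDegree_linear_le)).trans (mul_one _).le

lemma memMappedPoly_iff {k : ℕ} (hk : 1 ≤ k) {ψ : P.L2Bdry} :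
    (∀ e, P.MemMappedPoly k e ψ) ↔
      ∃ a : ι × Fin k → ℝ, ψ = ∑ s, a s • P.edgeMonomialL2 s.1 s.2 := by
  constructor
  · intro h
    choose q hq hψ using h
    let p (e : ι) : Polynomial ℝ := (q e).comp (Polynomial.C (P.b e - P.a e) * Polynomial.X +
      Polynomial.C ((P.a e + P.b e) / 2))
    have hp (e : ι) : (p e).natDegree < k :=
      (natDegree_comp_linear_le _ _ _).trans_lt ((mem_degreeLT_iff_natDegree_lt hk).1 (hq e))
    refine ⟨fun s => (p s.1).coeff s.2, Lp.ext (ae_bdryMeasure_iff.2 fun e => ?_)⟩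
    filter_upwards [hψ e, sum_edgeMonomialL2_ae (P := P)
      (fun s : ι × Fin k => (p s.1).coeff s.2) e] with x h1 h2
    rw [h1, h2]
    have hab : P.b e - P.a e ≠ 0 := (sub_pos.2 (P.a_lt_b e)).ne'
    have h3 : (q e).eval (P.γInv e x) =
        (p e).eval ((P.γInv e x - (P.a e + P.b e) / 2) / (P.b e - P.a e)) := by
      simp only [p, Polynomial.eval_comp, Polynomial.eval_add, Polynomial.eval_mul,
        Polynomial.eval_C, Polynomial.eval_X]
      congr 1
      field_simp
      ring
    rw [h3, Polynomial.eval_eq_sum_range' (hp e), Finset.sum_range]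
    rfl
  · rintro ⟨a, rfl⟩ e
    let p : Polynomial ℝ := ∑ i : Fin k, Polynomial.C (a (e, i)) * Polynomial.X ^ (i : ℕ)
    have hp : p.natDegree < k := by
      refine lt_of_le_of_lt (Polynomial.natDegree_sum_le_of_forall_le (n := k - 1) _ _
        fun i _ => ?_) (by omega)
      exact (Polynomial.natDegree_C_mul_X_pow_le _ _).trans (by have := i.2; omega)
    refine ⟨p.comp (Polynomial.C (P.b e - P.a e)⁻¹ * Polynomial.X +
      Polynomial.C (-((P.a e + P.b e) / 2 / (P.b e - P.a e)))),
      (mem_degreeLT_iff_natDegree_lt hk).2 ((natDegree_comp_linear_le _ _ _).trans_lt hp), ?_⟩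
    filter_upwards [sum_edgeMonomialL2_ae (P := P) a e] with x hx
    rw [hx]
    simp only [p, Polynomial.eval_comp, Polynomial.eval_add, Polynomial.eval_mul,
      Polynomial.eval_C, Polynomial.eval_X, Polynomial.eval_finsetSum, Polynomial.eval_pow,
      edgeMonomial]
    refine Finset.sum_congr rfl fun i _ => ?_
    congr 2
    ring

/-- On one edge only its own monomials survive; pulled back to the parameter interval, the
combination is a polynomial with infinitely many zeros. -/
lemma linearIndependent_edgeMonomialL2 (k : ℕ) :
    LinearIndependent ℝ fun s : ι × Fin k => P.edgeMonomialL2 s.1 s.2 := by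
  rw [Fintype.linearIndependent_iff]
  rintro a ha ⟨e, j⟩
  have hab := P.a_lt_b e
  have h1 : ∀ᵐ x ∂P.edgeMeasure e,
      x ∈ P.arc e ∧ ∑ i : Fin k, a (e, i) * P.edgeMonomial e i x = 0 := by
    filter_upwards [sum_edgeMonomialL2_ae (P := P) a e, ae_edgeMeasure_mem_arc e,
      ae_edgeMeasure_of_ae_bdryMeasure (Lp.coeFn_zero ℝ 2 P.bdryMeasure) e] with x h1 h2 h3
    refine ⟨h2, ?_⟩
    rw [← h1, ha, h3, Pi.zero_apply]
  let p : Polynomial ℝ := ∑ i : Fin k, Polynomial.C (a (e, i)) * Polynomial.X ^ (i : ℕ)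
  let s : ℝ → ℝ := fun t => (t - (P.a e + P.b e) / 2) / (P.b e - P.a e)
  have hs : Function.Injective s := fun t t' h => by
    have := (div_left_inj' (sub_pos.2 hab).ne').1 h
    linarith
  have hp (x : Plane) : p.eval (s (P.γInv e x)) = ∑ i : Fin k, a (e, i) * P.edgeMonomial e i x := by
    simp only [p, Polynomial.eval_finsetSum, Polynomial.eval_mul, Polynomial.eval_C,
      Polynomial.eval_pow, Polynomial.eval_X]
    rfl
  have hpc : Continuous fun t => p.eval (s t) :=
    p.continuous.comp ((continuous_id.sub continuous_const).div_const _)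
  -- Passing to the parameter requires a measurable set; the image of the zero set is compact.
  have hcl : MeasurableSet (P.γ e '' (Icc (P.a e) (P.b e) ∩ {t | p.eval (s t) = 0})) := by
    refine (IsCompact.isClosed ((isCompact_Icc.inter_right
      (isClosed_eq hpc continuous_const)).image_of_continuousOn ?_)).measurableSet
    exact (P.contDiffOn e).continuousOn.mono inter_subset_left
  have h2 : ∀ᵐ x ∂P.edgeMeasure e,
      x ∈ P.γ e '' (Icc (P.a e) (P.b e) ∩ {t | p.eval (s t) = 0}) := by
    filter_upwards [h1] with x hx
    obtain ⟨⟨t, ht, rfl⟩, hx2⟩ := hx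
    rw [← hp, γInv_γ e (Ioo_subset_Icc_self ht)] at hx2
    exact ⟨t, ⟨Ioo_subset_Icc_self ht, hx2⟩, rfl⟩
  have h3 := (P.ae_edgeMeasure_iff e
    (p := (· ∈ P.γ e '' (Icc (P.a e) (P.b e) ∩ {t | p.eval (s t) = 0}))) hcl).1 h2
  have h4 : (fun t => p.eval (s t)) =ᵐ[volume.restrict (Ioo (P.a e) (P.b e))] fun _ => 0 := by
    filter_upwards [h3, ae_restrict_mem measurableSet_Ioo] with t ht ht'
    obtain ⟨t', ⟨h5, h6⟩, h7⟩ := ht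
    rw [← P.injOn e h5 (Ioo_subset_Icc_self ht') h7]
    exact h6
  have h5 := Measure.eqOn_open_of_ae_eq h4 isOpen_Ioo hpc.continuousOn continuousOn_const
  have hp0 : p = 0 := by
    refine Polynomial.eq_zero_of_infinite_isRoot p
      (((Ioo_infinite hab).image hs.injOn).mono ?_)
    rintro _ ⟨t, ht, rfl⟩
    exact h5 ht
  have h6 : p.coeff j = a (e, j) := by
    simp only [p, Polynomial.finsetSum_coeff, Polynomial.coeff_C_mul, Polynomial.coeff_X_pow]
    rw [Finset.sum_eq_single j]
    · simp
    · intro i _ hi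
      rw [if_neg fun hh => hi (Fin.ext hh.symm), mul_zero]
    · simp
  rw [← h6, hp0, Polynomial.coeff_zero]

lemma edgeLength_pos (e : ι) : 0 < P.edgeLength e := by
  refine intervalIntegral.intervalIntegral_pos_of_pos_on ?_ (fun t ht => ?_) (P.a_lt_b e)
  · refine ContinuousOn.intervalIntegrable ?_
    rw [uIcc_of_le (P.a_lt_b e).le]
    exact (P.continuousOn_derivWithin_γ e).norm
  · exact norm_pos_iff.2 (P.regular e t (Ioo_subset_Icc_self ht))

lemma edgeMeasure_ne_zero (e : ι) : P.edgeMeasure e ≠ 0 := by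
  intro h
  have h1 : ∀ᵐ x ∂P.edgeMeasure e, x ∈ (∅ : Set Plane) := by rw [h]; simp
  have h2 := (P.ae_edgeMeasure_iff e (p := (· ∈ (∅ : Set Plane))) MeasurableSet.empty).1 h1
  simp only [mem_empty_iff_false, eventually_false_iff_eq_bot, ae_eq_bot,
    Measure.restrict_eq_zero, Real.volume_Ioo, ENNReal.ofReal_eq_zero] at h2
  linarith [P.a_lt_b e]

/-- With no edges the frontier would be empty, and `K` would be empty or the whole plane. -/
lemma nonempty_edges (P : CurvedPolygon ι) : Nonempty ι := by
  by_contra h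
  rw [not_nonempty_iff] at h
  have h1 : frontier P.K = ∅ := by rw [P.frontier_eq]; simp
  rcases frontier_eq_empty_iff.1 h1 with h2 | h2
  · exact P.nonempty.ne_empty h2
  · exact NormedSpace.unbounded_univ ℝ Plane (h2 ▸ P.bounded)

end CurvedPolygon

namespace CurvedPolygon

variable {ι : Type*} [Fintype ι] {P : CurvedPolygon ι}

/-! ### The degrees of freedom as functionals on the Sobolev space -/

variable (P) in
/-- The degrees of freedom as continuous linear functionals on the Sobolev space. -/
noncomputable def dofCLM (k : ℕ) : (ι × Fin k) ⊕ BulkIndex ((k : ℤ) - 2) → P.sobolev →L[ℝ] ℝ :=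
  Sum.elim
    (fun s => (P.edgeLength s.1)⁻¹ • (innerSL ℝ (P.edgeMonomialL2 s.1 s.2)).comp P.traceCLM)
    (fun α => (volume.real P.K)⁻¹ • (innerSL ℝ (P.bulkMonomialL2 α.1)).comp P.val)

lemma dofCLM_inl (k : ℕ) (s : ι × Fin k) (x : P.sobolev) : P.dofCLM k (Sum.inl s) x =
    (P.edgeLength s.1)⁻¹ * inner ℝ (P.edgeMonomialL2 s.1 s.2) (P.traceCLM x) := rfl

lemma dofCLM_inr (k : ℕ) (α : BulkIndex ((k : ℤ) - 2)) (x : P.sobolev) :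
    P.dofCLM k (Sum.inr α) x =
      (volume.real P.K)⁻¹ * inner ℝ (P.bulkMonomialL2 α.1) (P.val x) := rfl

lemma dofs_apply {k : ℕ} {v : P.localSpace k} {x : P.sobolev} (hx : P.val x = v) (j) :
    P.dofs k v j = P.dofCLM k j x := by
  rcases j with s | α
  · rw [dofCLM_inl, ← trace_val, hx, ← edgeDof_eq_inner]
    rfl
  · rw [dofCLM_inr, hx, ← bulkDof_eq_inner]
    rfl

/-- Gathers a combination of moments into one boundary density and one bulk density, to be read as
the flux and the source in Green's formula. -/
lemma sum_dofCLM {k : ℕ} (l : (ι × Fin k) ⊕ BulkIndex ((k : ℤ) - 2) → ℝ) (x : P.sobolev) :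
    ∑ j, l j * P.dofCLM k j x =
      inner ℝ (∑ s : ι × Fin k,
        (l (Sum.inl s) * (P.edgeLength s.1)⁻¹) • P.edgeMonomialL2 s.1 s.2) (P.traceCLM x) +
      inner ℝ (∑ α : BulkIndex ((k : ℤ) - 2),
        (l (Sum.inr α) * (volume.real P.K)⁻¹) • P.bulkMonomialL2 α.1) (P.val x) := by
  rw [Fintype.sum_sum_type, sum_inner, sum_inner]
  simp only [dofCLM_inl, dofCLM_inr, real_inner_smul_left, mul_assoc]

lemma exists_sobolev_of_mem_localSpace {k : ℕ} {v : P.L2} (hv : v ∈ P.localSpace k) :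
    ∃ x : P.sobolev, P.val x = v := by
  obtain ⟨g, f, ψ, h, -⟩ := hv
  exact ⟨h.toSobolev, rfl⟩

lemma IsTest.traceCLM_eq_zero {φ : Plane → ℝ} (hφ : P.IsTest φ) :
    P.traceCLM (P.smoothToSobolev ⟨φ, hφ.1⟩) = 0 := by
  rw [traceCLM_smooth]
  refine Lp.ext ?_
  filter_upwards [(memLp_bdry_smooth (P := P) ⟨φ, hφ.1⟩).coeFn_toLp, P.ae_bdryMeasure_mem_frontier,
    Lp.coeFn_zero ℝ 2 P.bdryMeasure] with x h1 h2 h3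
  refine h1.trans ?_
  rw [h3, Pi.zero_apply]
  exact image_eq_zero_of_notMem_tsupport fun h => (P.isOpen.frontier_eq ▸ h2).2 (hφ.2.2 h)

lemma eq_zero_of_inner_test {f : P.L2}
    (h : ∀ φ, ∀ hφ : P.IsTest φ, inner ℝ f (P.val (P.smoothToSobolev ⟨φ, hφ.1⟩)) = 0) : f = 0 := by
  have hloc : LocallyIntegrableOn f P.K volume := by
    have : IntegrableOn f P.K volume := (Lp.memLp f).integrable (by norm_num)
    exact this.locallyIntegrableOn
  have hz := P.isOpen.ae_eq_zero_of_integral_contDiff_smul_eq_zero hloc fun φ h1 h2 h3 => by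
    have h4 := h φ ⟨h1, h2, h3⟩
    rw [L2.inner_def] at h4
    rw [← setIntegral_eq_integral_of_forall_compl_eq_zero (s := P.K), ← h4]
    · refine integral_congr_ae ?_
      filter_upwards [(memLp_smooth (P := P) ⟨φ, h1⟩).coeFn_toLp] with x hx
      change φ x * f x = inner ℝ (f x) ((MemLp.toLp _ (memLp_smooth (P := P) ⟨φ, h1⟩) : P.L2) x)
      rw [hx]
      rfl
    · intro x hx
      rw [image_eq_zero_of_notMem_tsupport fun hx' => hx (h3 hx'), zero_smul]
  refine Lp.ext ((ae_restrict_iff' P.isOpen.measurableSet).2 ?_)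
  have h0 := (ae_restrict_iff' P.isOpen.measurableSet).1 (Lp.coeFn_zero ℝ 2 P.bulkMeasure)
  filter_upwards [hz, h0] with x hx hx0 hxK
  rw [hx hxK, hx0 hxK, Pi.zero_apply]

/-- The boundary measure is a finite measure on the plane, so smooth functions of the plane already
detect zero in `L²(∂K)`. -/
lemma eq_zero_of_inner_smoothToBdry {ψ : P.L2Bdry}
    (h : ∀ φ, inner ℝ ψ (P.smoothToBdry φ) = 0) : ψ = 0 := by
  have hloc : LocallyIntegrable ψ P.bdryMeasure :=
    ((Lp.memLp ψ).integrable (by norm_num)).locallyIntegrable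
  have hz := ae_eq_zero_of_integral_contDiff_smul_eq_zero hloc fun φ h1 h2 => by
    have h4 := h ⟨φ, h1⟩
    rw [L2.inner_def] at h4
    rw [← h4]
    refine integral_congr_ae ?_
    filter_upwards [(memLp_bdry_smooth (P := P) ⟨φ, h1⟩).coeFn_toLp] with x hx
    change φ x * ψ x =
      inner ℝ (ψ x) ((MemLp.toLp _ (memLp_bdry_smooth (P := P) ⟨φ, h1⟩) : P.L2Bdry) x)
    rw [hx]
    rfl
  refine Lp.ext ?_
  filter_upwards [hz, Lp.coeFn_zero ℝ 2 P.bdryMeasure] with x hx hx0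
  rw [hx, hx0, Pi.zero_apply]

variable (P) in
-- Test functions have zero trace and so isolate the bulk density, which must vanish; restrictions
-- of smooth functions then force the boundary density to vanish. The rest is independence of the
-- monomials.
lemma linearIndependent_dofCLM (k : ℕ) : LinearIndependent ℝ (P.dofCLM k) := by
  rw [Fintype.linearIndependent_iff]
  intro l hl
  have h0 (x : P.sobolev) : ∑ j, l j * P.dofCLM k j x = 0 := by
    have := congrArg (fun L : P.sobolev →L[ℝ] ℝ => L x) hl
    simpa [_root_.sum_apply] using this
  simp only [sum_dofCLM] at h0
  have hF := eq_zero_of_inner_test fun φ hφ => by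
    have := h0 (P.smoothToSobolev ⟨φ, hφ.1⟩)
    rwa [hφ.traceCLM_eq_zero, inner_zero_right, zero_add] at this
  rw [hF] at h0
  have hΨ := eq_zero_of_inner_smoothToBdry fun φ => by
    have := h0 (P.smoothToSobolev φ)
    rwa [traceCLM_smooth, inner_zero_left, add_zero] at this
  rintro (s | α)
  · have := Fintype.linearIndependent_iff.1 (linearIndependent_edgeMonomialL2 (P := P) k) _ hΨ s
    exact (mul_eq_zero.1 this).resolve_right (inv_ne_zero (edgeLength_pos s.1).ne')
  · have := Fintype.linearIndependent_iff.1
      (linearIndependent_bulkMonomialL2 (P := P) ((k : ℤ) - 2)) _ hF α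
    exact (mul_eq_zero.1 this).resolve_right (inv_ne_zero P.volume_real_pos.ne')

/-- The moment of order 0 is the mean over the edge; it is the functional that controls the
constants. -/
lemma dofCLM_smoothOne_ne_zero {k : ℕ} (e : ι) (i : Fin k) (hi : (i : ℕ) = 0) :
    P.dofCLM k (Sum.inl (e, i)) (P.smoothToSobolev smoothOne) ≠ 0 := by
  rw [dofCLM_inl, ← trace_val, ← edgeDof_eq_inner, edgeDof, trace_val, traceCLM_smooth]
  refine mul_ne_zero (inv_ne_zero (edgeLength_pos e).ne') ?_
  have h1 : ∫ x, P.smoothToBdry smoothOne x * P.edgeMonomial e i x ∂P.edgeMeasure e =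
      ∫ _, (1 : ℝ) ∂P.edgeMeasure e := by
    refine integral_congr_ae ?_
    filter_upwards [ae_edgeMeasure_of_ae_bdryMeasure
      (memLp_bdry_smooth (P := P) smoothOne).coeFn_toLp e] with x hx
    have h2 : P.smoothToBdry smoothOne x = 1 := hx
    rw [h2, edgeMonomial, hi, pow_zero, one_mul]
  rw [h1, integral_const, smul_eq_mul, mul_one]
  exact (measureReal_ne_zero_iff (measure_ne_top _ _)).2
    (Measure.measure_univ_ne_zero.2 (edgeMeasure_ne_zero e))

variable (P) in
lemma exists_coercive_dofCLM {k : ℕ} (hk : 1 ≤ k) : ∃ c : ℝ, 0 < c ∧ ∀ x : P.sobolev,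
    c * ‖x‖ ^ 2 ≤ ‖P.grad x‖ ^ 2 + ∑ j, P.dofCLM k j x ^ 2 := by
  obtain ⟨e⟩ := P.nonempty_edges
  obtain ⟨c, hc, h⟩ := exists_coercive (dofCLM_smoothOne_ne_zero (P := P) e (⟨0, hk⟩ : Fin k) rfl)
  refine ⟨c, hc, fun x => (h x).trans ?_⟩
  gcongr
  exact Finset.single_le_sum (f := fun j => P.dofCLM k j x ^ 2) (fun j _ => sq_nonneg _)
    (Finset.mem_univ _)

/-! ### Unisolvence. -/

/-- Although `trace` is defined by choice, on `H¹(K)` it coincides with the linear operator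
`traceCLM`. -/
lemma isLinearMap_dofs (k : ℕ) : IsLinearMap ℝ (P.dofs k) where
  map_add v w := by
    obtain ⟨x, hx⟩ := exists_sobolev_of_mem_localSpace v.2
    obtain ⟨y, hy⟩ := exists_sobolev_of_mem_localSpace w.2
    ext j
    have hxy : P.val (x + y) = (v + w : P.localSpace k) := by rw [map_add, hx, hy]; rfl
    rw [Pi.add_apply, dofs_apply hx, dofs_apply hy, dofs_apply hxy, map_add]
  map_smul a v := by
    obtain ⟨x, hx⟩ := exists_sobolev_of_mem_localSpace v.2
    ext j
    have hax : P.val (a • x) = (a • v : P.localSpace k) := by rw [map_smul, hx]; rfl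
    rw [Pi.smul_apply, dofs_apply hx, dofs_apply hax, map_smul]

lemma existsUnique_isTrace {k : ℕ} {v : P.L2} (hv : v ∈ P.localSpace k) : ∃! t, P.IsTrace v t := by
  obtain ⟨x, rfl⟩ := exists_sobolev_of_mem_localSpace hv
  exact ⟨P.traceCLM x, isTrace_val_iff.2 rfl, fun t ht => isTrace_val_iff.1 ht⟩

lemma eq_zero_of_dofs_eq_zero {k : ℕ} (hk : 1 ≤ k) {v : P.localSpace k} (hv : P.dofs k v = 0) :
    v = 0 := by
  obtain ⟨g, f, ψ, hg, -, hf, hψ, hm⟩ := v.2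
  set x := hg.toSobolev with hx
  have hD (j) : P.dofCLM k j x = 0 := by rw [← dofs_apply (v := v) rfl, hv, Pi.zero_apply]
  obtain ⟨a, ha⟩ := (memMappedPoly_iff hk).1 hm
  obtain ⟨b, hb⟩ := memBulkPoly_iff.1 hf
  have h1 : inner ℝ ψ (P.traceCLM x) = 0 := by
    rw [ha, sum_inner]
    refine Finset.sum_eq_zero fun s _ => ?_
    have := hD (Sum.inl s)
    rw [dofCLM_inl] at this
    rw [real_inner_smul_left, (mul_eq_zero.1 this).resolve_left
      (inv_ne_zero (edgeLength_pos s.1).ne'), mul_zero]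
  have h2 : inner ℝ f (P.val x) = 0 := by
    rw [hb, sum_inner]
    refine Finset.sum_eq_zero fun α _ => ?_
    have := hD (Sum.inr α)
    rw [dofCLM_inr] at this
    rw [real_inner_smul_left, (mul_eq_zero.1 this).resolve_left
      (inv_ne_zero P.volume_real_pos.ne'), mul_zero]
  -- Green's formula with `v` itself as the test function; the boundary and source terms are
  -- combinations of vanishing moments.
  have h3 := hasNormalComponent_iff.1 hψ (P.val x) (P.grad x) (P.traceCLM x)
    (hasWeakGradient_val x) (isTrace_val_iff.2 rfl)
  rw [h1, h2, add_zero] at h3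
  have h4 : ‖P.grad x‖ ^ 2 = 0 := by rw [← real_inner_self_eq_norm_sq]; exact h3
  obtain ⟨c, hc, h⟩ := P.exists_coercive_dofCLM hk
  have h5 := h x
  simp only [h4, hD, ne_eq, OfNat.ofNat_ne_zero, not_false_eq_true, zero_pow,
    Finset.sum_const_zero, add_zero] at h5
  have h6 : ‖x‖ ^ 2 ≤ 0 := nonpos_of_mul_nonpos_right h5 hc
  have h7 : x = 0 :=
    norm_eq_zero.1 (pow_eq_zero_iff two_ne_zero |>.1 (le_antisymm h6 (by positivity)))
  have h8 : P.val x = v := rfl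
  rw [h7, map_zero] at h8
  exact Subtype.ext h8.symm

/-- The hypothesis is the weak form of a Neumann problem. Test functions see no boundary term and
identify the Laplacian; general `w` then identify the normal derivative. -/
lemma val_mem_localSpace {k : ℕ} (hk : 1 ≤ k) {x : P.sobolev}
    {l : (ι × Fin k) ⊕ BulkIndex ((k : ℤ) - 2) → ℝ}
    (h : ∀ w, inner ℝ (P.grad x) (P.grad w) = ∑ j, l j * P.dofCLM k j w) :
    P.val x ∈ P.localSpace k := by
  simp only [sum_dofCLM] at h
  set ψ : P.L2Bdry := ∑ s : ι × Fin k,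
    (l (Sum.inl s) * (P.edgeLength s.1)⁻¹) • P.edgeMonomialL2 s.1 s.2 with hψ
  set f : P.L2 := ∑ α : BulkIndex ((k : ℤ) - 2),
    (l (Sum.inr α) * (volume.real P.K)⁻¹) • P.bulkMonomialL2 α.1 with hf
  -- The source stands on the right-hand side of the hypothesis but on the left in Green's formula,
  -- so the Laplacian is `-f`.
  refine ⟨P.grad x, -f, ψ, hasWeakGradient_val x, ?_, memBulkPoly_iff.2
    ⟨fun α => -(l (Sum.inr α) * (volume.real P.K)⁻¹), ?_⟩, ?_, (memMappedPoly_iff hk).2 ⟨_, hψ⟩⟩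
  · refine hasWeakDivergence_iff.2 fun φ hφ => ?_
    have h1 := h (P.smoothToSobolev ⟨φ, hφ.1⟩)
    rw [hφ.traceCLM_eq_zero, inner_zero_right, zero_add] at h1
    rw [inner_neg_left, neg_neg]
    exact h1
  · simp only [hf, neg_smul, Finset.sum_neg_distrib]
  · refine hasNormalComponent_iff.2 fun w gw t hw ht => ?_
    have h1 := h hw.toSobolev
    have h2 : t = P.traceCLM hw.toSobolev := isTrace_val_iff.1 ht
    rw [← h2] at h1
    rw [inner_neg_left]
    change inner ℝ (P.grad x) gw = inner ℝ ψ t + inner ℝ f w at h1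
    rw [h1, add_neg_cancel_right]

lemma bijective_dofs {k : ℕ} (hk : 1 ≤ k) : Function.Bijective (P.dofs k) := by
  constructor
  · exact (injective_iff_map_eq_zero (isLinearMap_dofs (P := P) k).mk').2
      fun v hv => eq_zero_of_dofs_eq_zero hk hv
  · intro d
    obtain ⟨c, hc, h⟩ := P.exists_coercive_dofCLM hk
    obtain ⟨x, l, hx, hl⟩ :=
      exists_moments_of_coercive P.grad (P.dofCLM k) (P.linearIndependent_dofCLM k) hc h d
    refine ⟨⟨P.val x, val_mem_localSpace hk hl⟩, ?_⟩
    ext j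
    rw [dofs_apply (x := x) rfl, hx]

end CurvedPolygon

theorem mainTheorem8 {ι : Type*} [Fintype ι] (P : CurvedPolygon ι) (k : ℕ) (hk : 1 ≤ k) :
    (∀ v ∈ P.localSpace k, ∃! t, P.IsTrace v t) ∧
      IsLinearMap ℝ (P.dofs k) ∧ Function.Bijective (P.dofs k) :=
  ⟨fun _ hv => CurvedPolygon.existsUnique_isTrace hv, CurvedPolygon.isLinearMap_dofs k,
    CurvedPolygon.bijective_dofs hk⟩
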